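/- Let $n\ge 3$ be an integer, $0<m<\frac{n-2}{n}$, $\beta<0$, $\rho_1>0$, $\alpha=\frac{2\beta-\rho_1}{1-m}$, and suppose that $\frac{2}{1-m}<\frac{\alpha}{\beta}<\frac{n-2}{m}$. Then for every $A>0$ there exists a unique radially symmetric, positive function $f\in C^2(\mathbb R^n\setminus\{0\})$ which satisfies $$\Delta f^m+\alpha f+\beta\, x\cdot\nabla f=0\quad\text{in }\mathbb R^n\setminus\{0\},$$ $$\lim_{|x|\to 0}|x|^{\alpha/\beta}f(x)=A,$$ and $$\lim_{|x|\to\infty}|x|^{(n-2)/m}f(x)=D_A\quad\text{for some constant }D_A>0\text{ depending on }A .$$ (Uniqueness is among all such functions that satisfy the equation, the condition at the origin with the given $A$, and the condition at infinity with some positive constant, which is not prescribed.) Moreover $$\Delta f^m=-(\alpha f+\beta\, x\cdot\nabla f)<0\quad\text{in }\mathbb R^n\setminus\{0\}.$$ -/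

import Mathlib

open Filter Topology

namespace SelfSimilar

/-- The drift term `α f + β x · ∇f` at the point `x` of `ℝⁿ`. -/
noncomputable def drift {n : ℕ} (α β : ℝ) (f : EuclideanSpace ℝ (Fin n) → ℝ)
    (x : EuclideanSpace ℝ (Fin n)) : ℝ :=
  α * f x + β * inner ℝ x (gradient f x)

/-- The Laplacian of the power `f ^ m` at the point `x` of `ℝⁿ`. -/
noncomputable def lapPow {n : ℕ} (m : ℝ) (f : EuclideanSpace ℝ (Fin n) → ℝ)
    (x : EuclideanSpace ℝ (Fin n)) : ℝ :=
  Laplacian.laplacian (fun y => f y ^ m) x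

/-- `f` is a radially symmetric, positive, classical (i.e. `C²`) solution of
`Δ f ^ m + α f + β x · ∇f = 0` in `ℝⁿ ∖ {0}`. The value of `f` at the origin plays no role. -/
structure IsRadialProfile (n : ℕ) (m α β : ℝ) (f : EuclideanSpace ℝ (Fin n) → ℝ) : Prop where
  contDiffOn : ContDiffOn ℝ 2 f {0}ᶜ
  pos : ∀ x, x ≠ 0 → 0 < f x
  radial : ∀ x y, ‖x‖ = ‖y‖ → f x = f y
  equation : ∀ x, x ≠ 0 → lapPow m f x + drift α β f x = 0

/-- `|x| ^ (α / β) f(x) → A` as `|x| → 0`. -/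
def OriginBehaviour {n : ℕ} (α β A : ℝ) (f : EuclideanSpace ℝ (Fin n) → ℝ) : Prop :=
  Tendsto (fun x => ‖x‖ ^ (α / β) * f x) (𝓝[≠] 0) (𝓝 A)

/-- `|x| ^ ((n - 2) / m) f(x) → D` as `|x| → ∞`. -/
def InftyBehaviour {n : ℕ} (m D : ℝ) (f : EuclideanSpace ℝ (Fin n) → ℝ) : Prop :=
  Tendsto (fun x => ‖x‖ ^ (((n : ℝ) - 2) / m) * f x)
    (Bornology.cobounded (EuclideanSpace ℝ (Fin n))) (𝓝 D)

end SelfSimilar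

/-! Put N = n - 2, q = 1/m, and write f^m(x) = w(y) with y = |x|^(-N). Since |x|^(-N) is harmonic
off the origin, Δf^m becomes N² y^θ w'' with θ = 2 + 2/N, and the elliptic equation becomes w'' = -B
y^(-θ) w^(q-1) (q y w' - k w). Infinity in x is now y = 0, where w/y has a limit E > 0, and the
origin is y = ∞, where y^(-k) w^q → A.

Everything rests on the sign of the excess q y w' - k w. It is positive near y = 0 because k < q,
and at a zero its derivative is (q - k) w' > 0, so it never vanishes (`excess_pos`). Hence w is
increasing and concave with w ≤ E y. Concavity is the asserted sign of Δf^m.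

For a prescribed slope E, integrating twice in the variables z = w/y, τ = y^σ, σ = q - θ + 1 > 0,
turns the singular problem into a regular Volterra equation. With the power truncated it is globally
Lipschitz and is solved by a contraction (`existsUnique_volterra`); the bounds 0 < w ≤ E y then show
that the truncation is inactive (`exists_profile`, `eqOn_of_slope`).

At infinity a positive excess makes y^(-k) w^q increasing, and a Lyapunov functional bounds it
(`log_quotient_bounded`), so it has a positive limit. Finally, the scaling w ↦ μ^e w(μ·) multiplies
both the slope E and the limit A by powers of μ with positive exponents. Thus every A is attained,
and A determines E and therefore w (`exists_profile_of_limit`, `eqOn_of_limit`). -/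

namespace SelfSimilar

open Set

/-! ### The profile equation: monotonicity, concavity and a priori bounds. -/

/-- On `s`, the function `w` is positive, has derivative `p`, and solves
`w'' = B y ^ (-θ) (k w ^ q - q y w ^ (q - 1) w')`. -/
structure ProfileODE (B q k θ : ℝ) (w p : ℝ → ℝ) (s : Set ℝ) : Prop where
  pos : ∀ y ∈ s, 0 < w y
  deriv_fst : ∀ y ∈ s, HasDerivAt w (p y) y
  deriv_snd : ∀ y ∈ s,
    HasDerivAt p (B * y ^ (-θ) * (k * w y ^ q - q * y * w y ^ (q - 1) * p y)) y

namespace ProfileODE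

variable {B q k θ E Y : ℝ} {w p : ℝ → ℝ} {s t : Set ℝ}

theorem mono (h : ProfileODE B q k θ w p s) (hts : t ⊆ s) : ProfileODE B q k θ w p t :=
  ⟨fun y hy => h.pos y (hts hy), fun y hy => h.deriv_fst y (hts hy),
    fun y hy => h.deriv_snd y (hts hy)⟩

theorem hasDerivAt_excess (h : ProfileODE B q k θ w p s) {y : ℝ} (hy : y ∈ s) :
    HasDerivAt (fun y => q * y * p y - k * w y)
      ((q - k) * p y
        + q * y * (B * y ^ (-θ) * (k * w y ^ q - q * y * w y ^ (q - 1) * p y))) y := by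
  have h1 := (((hasDerivAt_id y).const_mul q).mul (h.deriv_snd y hy)).sub
    ((h.deriv_fst y hy).const_mul k)
  refine h1.congr_deriv ?_
  simp only [id]
  ring

theorem rhs_eq (h : ProfileODE B q k θ w p s) {y : ℝ} (hy : y ∈ s) :
    B * y ^ (-θ) * (k * w y ^ q - q * y * w y ^ (q - 1) * p y)
      = -(B * y ^ (-θ) * w y ^ (q - 1)) * (q * y * p y - k * w y) := by
  have : w y ^ q = w y ^ (q - 1) * w y := by
    rw [← Real.rpow_add_one (h.pos y hy).ne']; congr 1; ring
  rw [this]; ring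

/-- The right-hand side of the equation is a multiple of the excess, so at a zero only (q - k) w'
survives, and there w' = k w / (q y) > 0. Zeros of the excess can therefore only be crossed upwards.
-/
theorem excess_deriv_pos (h : ProfileODE B q k θ w p s) (hs : s ⊆ Ioi 0) (hk : 0 < k)
    (hkq : k < q) {y : ℝ} (hy : y ∈ s) (h0 : q * y * p y - k * w y = 0) :
    0 < (q - k) * p y
        + q * y * (B * y ^ (-θ) * (k * w y ^ q - q * y * w y ^ (q - 1) * p y)) := by
  have hy0 : 0 < y := hs hy
  have hw := h.pos y hy
  rw [h.rhs_eq hy, h0, mul_zero, mul_zero, add_zero]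
  have hp : 0 < q * y * p y := by
    have : q * y * p y = k * w y := by linarith
    rw [this]; positivity
  have : 0 < p y := pos_of_mul_pos_right hp (by have := hk.trans hkq; positivity)
  exact mul_pos (by linarith) this

/-- The quantity `q y w' - k w` is positive for a solution that starts with slope `E > 0`. -/
theorem excess_pos (h : ProfileODE B q k θ w p (Ioo 0 Y)) (hk : 0 < k) (hkq : k < q) (hE : 0 < E)
    (hwE : Tendsto (fun y => w y / y) (𝓝[>] 0) (𝓝 E)) (hpE : Tendsto p (𝓝[>] 0) (𝓝 E))
    {y : ℝ} (hy : y ∈ Ioo 0 Y) : 0 < q * y * p y - k * w y := by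
  have hsub : Ioo 0 Y ⊆ Ioi (0 : ℝ) := fun y hy => hy.1
  have hev : ∀ᶠ y in 𝓝[>] (0 : ℝ), 0 < q * y * p y - k * w y := by
    have h1 : Tendsto (fun y => q * p y - k * (w y / y)) (𝓝[>] 0) (𝓝 (q * E - k * E)) :=
      (hpE.const_mul q).sub (hwE.const_mul k)
    have h2 : 0 < q * E - k * E := by nlinarith
    filter_upwards [h1.eventually (lt_mem_nhds h2), self_mem_nhdsWithin] with y h3 h4
    have h4' : (0 : ℝ) < y := h4
    have : q * y * p y - k * w y = y * (q * p y - k * (w y / y)) := by field_simp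
    rw [this]; positivity
  have hnonneg : ∀ b ∈ Ioo 0 Y, 0 ≤ q * b * p b - k * w b := by
    intro b hb
    -- Start the barrier comparison at a point a < b so close to 0 that the excess is already
    -- positive.
    obtain ⟨a, ha, hab⟩ := (hev.and (Ioo_mem_nhdsGT hb.1)).exists
    have hI : ∀ x ∈ Icc a b, x ∈ Ioo 0 Y := fun x hx =>
      ⟨hab.1.trans_le hx.1, hx.2.trans_lt hb.2⟩
    have key := image_le_of_deriv_right_lt_deriv_boundary' (a := a) (b := b)
      (f := fun y => -(q * y * p y - k * w y)) (B := fun _ => 0) (B' := fun _ => 0)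
      (f' := fun y => -((q - k) * p y
        + q * y * (B * y ^ (-θ) * (k * w y ^ q - q * y * w y ^ (q - 1) * p y))))
      (fun x hx => (h.hasDerivAt_excess (hI x hx)).neg.continuousAt.continuousWithinAt)
      (fun x hx => (h.hasDerivAt_excess (hI x (Ico_subset_Icc_self hx))).neg.hasDerivWithinAt)
      (by linarith) continuousOn_const (fun x _ => hasDerivWithinAt_const _ _ _)
      (fun x hx hx0 => by
        have := h.excess_deriv_pos hsub hk hkq (hI x (Ico_subset_Icc_self hx)) (by linarith)
        linarith)
      (right_mem_Icc.2 hab.2.le)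
    simpa using key
  -- A zero would be an interior minimum of a nonnegative function, contradicting the positive
  -- derivative there.
  refine lt_of_le_of_ne (hnonneg y hy) fun h0 => ?_
  have hmin : IsLocalMin (fun y => q * y * p y - k * w y) y := by
    filter_upwards [isOpen_Ioo.mem_nhds hy] with x hx
    rw [← h0]; exact hnonneg x hx
  have := hmin.hasDerivAt_eq_zero (h.hasDerivAt_excess hy)
  linarith [h.excess_deriv_pos hsub hk hkq hy h0.symm]

theorem tendsto_fst_zero (hwE : Tendsto (fun y => w y / y) (𝓝[>] 0) (𝓝 E)) :
    Tendsto w (𝓝[>] 0) (𝓝 0) := by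
  have h1 : Tendsto (fun y : ℝ => y) (𝓝[>] 0) (𝓝 0) := nhdsWithin_le_nhds
  have h2 := h1.mul hwE
  rw [zero_mul] at h2
  refine h2.congr' ?_
  filter_upwards [self_mem_nhdsWithin] with y hy
  have : (0 : ℝ) < y := hy
  field_simp

/-- A positive excess means w'' < 0. This concavity gives the bound w ≤ E y and, in the original
variables, the sign of the Laplacian. -/
theorem rhs_neg (h : ProfileODE B q k θ w p (Ioo 0 Y)) (hB : 0 < B) (hk : 0 < k) (hkq : k < q)
    (hE : 0 < E)
    (hwE : Tendsto (fun y => w y / y) (𝓝[>] 0) (𝓝 E)) (hpE : Tendsto p (𝓝[>] 0) (𝓝 E))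
    {y : ℝ} (hy : y ∈ Ioo 0 Y) :
    B * y ^ (-θ) * (k * w y ^ q - q * y * w y ^ (q - 1) * p y) < 0 := by
  have hy0 := hy.1
  have hw := h.pos y hy
  have := h.excess_pos hk hkq hE hwE hpE hy
  rw [h.rhs_eq hy, neg_mul]
  exact neg_neg_of_pos (by positivity)

theorem snd_pos (h : ProfileODE B q k θ w p (Ioo 0 Y)) (hk : 0 < k) (hkq : k < q)
    (hE : 0 < E)
    (hwE : Tendsto (fun y => w y / y) (𝓝[>] 0) (𝓝 E)) (hpE : Tendsto p (𝓝[>] 0) (𝓝 E))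
    {y : ℝ} (hy : y ∈ Ioo 0 Y) : 0 < p y := by
  have h1 := h.excess_pos hk hkq hE hwE hpE hy
  have hy0 := hy.1
  have hw := h.pos y hy
  have : 0 < k * w y := by positivity
  exact pos_of_mul_pos_right (a := q * y) (by linarith) (by have := hk.trans hkq; positivity)

/-- A function on `(0, Y)` with nonpositive derivative lies below its limit at `0`. -/
theorem _root_.SelfSimilar.le_of_deriv_nonpos_of_tendsto {g g' : ℝ → ℝ} {c : ℝ}
    (hd : ∀ y ∈ Ioo 0 Y, HasDerivAt g (g' y) y) (hn : ∀ y ∈ Ioo 0 Y, g' y ≤ 0)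
    (hl : Tendsto g (𝓝[>] 0) (𝓝 c)) {y : ℝ} (hy : y ∈ Ioo 0 Y) : g y ≤ c := by
  have hanti : AntitoneOn g (Ioo 0 Y) := by
    refine antitoneOn_of_deriv_nonpos (convex_Ioo 0 Y)
      (fun x hx => (hd x hx).continuousAt.continuousWithinAt) ?_ ?_
    · rw [interior_Ioo]; exact fun x hx => (hd x hx).differentiableAt.differentiableWithinAt
    · rw [interior_Ioo]; exact fun x hx => by rw [(hd x hx).deriv]; exact hn x hx
  refine ge_of_tendsto hl ?_
  filter_upwards [Ioo_mem_nhdsGT hy.1] with x hx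
  exact hanti ⟨hx.1, hx.2.trans hy.2⟩ hy hx.2.le

theorem snd_le (h : ProfileODE B q k θ w p (Ioo 0 Y)) (hB : 0 < B) (hk : 0 < k) (hkq : k < q)
    (hE : 0 < E)
    (hwE : Tendsto (fun y => w y / y) (𝓝[>] 0) (𝓝 E)) (hpE : Tendsto p (𝓝[>] 0) (𝓝 E))
    {y : ℝ} (hy : y ∈ Ioo 0 Y) : p y ≤ E :=
  le_of_deriv_nonpos_of_tendsto h.deriv_snd
    (fun _ hx => (h.rhs_neg hB hk hkq hE hwE hpE hx).le) hpE hy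

theorem fst_le (h : ProfileODE B q k θ w p (Ioo 0 Y)) (hB : 0 < B) (hk : 0 < k) (hkq : k < q)
    (hE : 0 < E)
    (hwE : Tendsto (fun y => w y / y) (𝓝[>] 0) (𝓝 E)) (hpE : Tendsto p (𝓝[>] 0) (𝓝 E))
    {y : ℝ} (hy : y ∈ Ioo 0 Y) : w y ≤ E * y := by
  have h1 : Tendsto (fun y : ℝ => E * y) (𝓝[>] 0) (𝓝 0) := by
    have : Tendsto (fun y : ℝ => E * y) (𝓝 0) (𝓝 (E * 0)) := tendsto_id.const_mul E
    rw [mul_zero] at this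
    exact this.mono_left nhdsWithin_le_nhds
  have h2 := (tendsto_fst_zero hwE).sub h1
  rw [sub_zero] at h2
  have := le_of_deriv_nonpos_of_tendsto (g := fun y => w y - E * y) (g' := fun y => p y - E * 1)
    (fun x hx => (h.deriv_fst x hx).sub ((hasDerivAt_id x).const_mul E))
    (fun x hx => by linarith [h.snd_le hB hk hkq hE hwE hpE hx]) h2 hy
  linarith

theorem fst_strictMonoOn (h : ProfileODE B q k θ w p (Ioo 0 Y)) (hk : 0 < k)
    (hkq : k < q) (hE : 0 < E)
    (hwE : Tendsto (fun y => w y / y) (𝓝[>] 0) (𝓝 E)) (hpE : Tendsto p (𝓝[>] 0) (𝓝 E)) :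
    StrictMonoOn w (Ioo 0 Y) := by
  refine strictMonoOn_of_deriv_pos (convex_Ioo 0 Y)
      (fun x hx => (h.deriv_fst x hx).continuousAt.continuousWithinAt) ?_
  rw [interior_Ioo]
  intro x hx
  rw [(h.deriv_fst x hx).deriv]
  exact h.snd_pos hk hkq hE hwE hpE hx

/-! ### Asymptotics of the profile at infinity. -/

theorem hasDerivAt_log_quotient (h : ProfileODE B q k θ w p s) (hs : s ⊆ Ioi 0) {y : ℝ}
    (hy : y ∈ s) :
    HasDerivAt (fun y => q * Real.log (w y) - k * Real.log y)
      ((q * (y * p y / w y) - k) / y) y := by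
  have hy0 : 0 < y := hs hy
  have hw := h.pos y hy
  refine ((((h.deriv_fst y hy).log hw.ne').const_mul q).sub
    ((Real.hasDerivAt_log hy0.ne').const_mul k)).congr_deriv ?_
  field_simp

/-- With x = y w'/w, the log slope ψ = q x - k obeys a first-order equation: a source q x (1 - x)/y
and a damping term proportional to y^(1-θ) w^(q-1). -/
theorem hasDerivAt_log_slope (h : ProfileODE B q k θ w p s) (hs : s ⊆ Ioi 0) {y : ℝ}
    (hy : y ∈ s) :
    HasDerivAt (fun y => q * (y * p y / w y) - k)
      (q * (y * p y / w y) * (1 - y * p y / w y) / y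
        - q * B * (y ^ (1 - θ) * w y ^ (q - 1)) * (q * (y * p y / w y) - k)) y := by
  have hy0 : 0 < y := hs hy
  have hw := h.pos y hy
  refine (((((hasDerivAt_id y).mul (h.deriv_snd y hy)).div (h.deriv_fst y hy)
    hw.ne').const_mul q).sub_const k).congr_deriv ?_
  rw [h.rhs_eq hy]
  have : y ^ (1 - θ) = y * y ^ (-θ) := by
    rw [sub_eq_add_neg, Real.rpow_add hy0, Real.rpow_one]
  rw [this]
  simp only [id, Pi.mul_apply]
  field_simp
  ring

theorem log_slope_pos (h : ProfileODE B q k θ w p (Ioi 0)) (hk : 0 < k) (hkq : k < q)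
    (hE : 0 < E)
    (hwE : Tendsto (fun y => w y / y) (𝓝[>] 0) (𝓝 E)) (hpE : Tendsto p (𝓝[>] 0) (𝓝 E))
    {y : ℝ} (hy : 0 < y) : 0 < q * (y * p y / w y) - k := by
  have h1 := (h.mono (show Ioo 0 (y + 1) ⊆ Ioi 0 from Ioo_subset_Ioi_self)).excess_pos hk hkq hE hwE hpE
    (y := y) ⟨hy, by linarith⟩
  have hw := h.pos y hy
  have : q * (y * p y / w y) - k = (q * y * p y - k * w y) / w y := by field_simp
  rw [this]; positivity

theorem log_quotient_mono (h : ProfileODE B q k θ w p (Ioi 0)) (hk : 0 < k) (hkq : k < q)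
    (hE : 0 < E)
    (hwE : Tendsto (fun y => w y / y) (𝓝[>] 0) (𝓝 E)) (hpE : Tendsto p (𝓝[>] 0) (𝓝 E)) :
    MonotoneOn (fun y => q * Real.log (w y) - k * Real.log y) (Ioi 0) := by
  have hd := fun y (hy : y ∈ Ioi (0 : ℝ)) => h.hasDerivAt_log_quotient subset_rfl hy
  refine monotoneOn_of_deriv_nonneg (convex_Ioi 0)
      (fun x hx => (hd x hx).continuousAt.continuousWithinAt) ?_ ?_
  · rw [interior_Ioi]; exact fun x hx => (hd x hx).differentiableAt.differentiableWithinAt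
  · rw [interior_Ioi]
    intro x hx
    rw [(hd x hx).deriv]
    have := h.log_slope_pos hk hkq hE hwE hpE hx
    have : (0 : ℝ) < x := hx
    positivity

/-- The log quotient has derivative ψ/y, where ψ is the log slope. The source for ψ is at most
q/(4y), and its damping coefficient is at least c y^(δ-1) with δ > 0, which suggests that ψ decays
like y^(-δ) and that ψ/y is integrable. Adding positive multiples of y^(-δ) ψ and y^(-δ) to the log
quotient gives a decreasing functional, without solving for ψ. -/
theorem log_quotient_bounded (h : ProfileODE B q k θ w p (Ioi 0)) (hB : 0 < B) (hq : 1 < q)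
    (hk : 0 < k) (hkq : k < q) (hδ : (θ - 2) * q < k * (q - 1)) (hE : 0 < E)
    (hwE : Tendsto (fun y => w y / y) (𝓝[>] 0) (𝓝 E)) (hpE : Tendsto p (𝓝[>] 0) (𝓝 E)) :
    ∃ M, ∀ y, 1 ≤ y → q * Real.log (w y) - k * Real.log y ≤ M := by
  have hq0 : 0 < q := by linarith
  set δ := k * (q - 1) / q - (θ - 2) with hδdef
  have hδ0 : 0 < δ := by
    rw [hδdef, sub_pos, lt_div_iff₀ hq0]; exact hδ
  set c₀ := w 1 ^ (q - 1) with hc₀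
  have hw1 : 0 < w 1 := h.pos 1 (by simp)
  have hc₀pos : 0 < c₀ := by positivity
  -- The monotone log quotient, compared with its value at 1, gives w ≥ w(1) y^(k/q); hence the
  -- damping lower bound.
  have hlow : ∀ y, 1 ≤ y → c₀ * y ^ (δ - 1) ≤ y ^ (1 - θ) * w y ^ (q - 1) := by
    intro y hy
    have hy0 : 0 < y := by linarith
    have hw := h.pos y hy0
    have hm := h.log_quotient_mono hk hkq hE hwE hpE (show (1 : ℝ) ∈ Ioi (0 : ℝ) by simp)
      (show y ∈ Ioi (0 : ℝ) from hy0) hy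
    simp only [Real.log_one, mul_zero, sub_zero] at hm
    have h1 : Real.log (w 1) + k / q * Real.log y ≤ Real.log (w y) := by
      have : q * (Real.log (w 1) + k / q * Real.log y) ≤ q * Real.log (w y) := by
        have : q * (k / q * Real.log y) = k * Real.log y := by field_simp
        linarith
      exact le_of_mul_le_mul_left this hq0
    rw [hc₀, Real.rpow_def_of_pos hw1, Real.rpow_def_of_pos hy0, Real.rpow_def_of_pos hy0,
      Real.rpow_def_of_pos hw, ← Real.exp_add, ← Real.exp_add, Real.exp_le_exp]
    have h2 := mul_le_mul_of_nonneg_right h1 (show 0 ≤ q - 1 by linarith)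
    have h3 : δ - 1 = k / q * (q - 1) + (1 - θ) := by rw [hδdef]; ring
    rw [h3]
    linarith
  set c := q * B * c₀ with hc
  have hcpos : 0 < c := by positivity
  set ψ : ℝ → ℝ := fun y => q * (y * p y / w y) - k with hψ
  -- In L', the damping of the second term cancels ψ/y, and the third term absorbs the source. Both
  -- added terms are positive, so L dominates the log quotient.
  set L : ℝ → ℝ := fun y => (q * Real.log (w y) - k * Real.log y)
    + (y ^ (-δ) * ψ y) / c + (q / 4) / (c * δ) * y ^ (-δ) with hL
  have hLd : ∀ y, 0 < y → HasDerivAt L (ψ y / y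
      + (((-δ) * y ^ (-δ - 1)) * ψ y + y ^ (-δ) *
        (q * (y * p y / w y) * (1 - y * p y / w y) / y
        - q * B * (y ^ (1 - θ) * w y ^ (q - 1)) * ψ y)) / c
      + (q / 4) / (c * δ) * ((-δ) * y ^ (-δ - 1))) y := by
    intro y hy
    have hr := Real.hasDerivAt_rpow_const (x := y) (p := -δ) (Or.inl hy.ne')
    exact ((h.hasDerivAt_log_quotient subset_rfl hy).add
      ((hr.mul (h.hasDerivAt_log_slope subset_rfl hy)).div_const c)).add (hr.const_mul _)
  have hLanti : AntitoneOn L (Ici 1) := by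
    refine antitoneOn_of_deriv_nonpos (convex_Ici 1)
      (fun x hx => (hLd x (zero_lt_one.trans_le hx)).continuousAt.continuousWithinAt) ?_ ?_
    · rw [interior_Ici]
      exact fun x hx => (hLd x (zero_lt_one.trans hx)).differentiableAt.differentiableWithinAt
    · rw [interior_Ici]
      intro y hy
      have hy1 : 1 < y := hy
      have hy0 : 0 < y := by linarith
      rw [(hLd y hy0).deriv]
      have hψ0 : 0 < ψ y := h.log_slope_pos hk hkq hE hwE hpE hy0
      set x := y * p y / w y
      set a := y ^ (1 - θ) * w y ^ (q - 1)
      have ha : c₀ * y ^ (δ - 1) ≤ a := hlow y hy1.le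
      set r := y ^ (-δ) with hr
      have hr0 : 0 < r := by positivity
      have hr1 : y ^ (-δ - 1) = r / y := by rw [Real.rpow_sub_one hy0.ne']
      have hr2 : r * y ^ (δ - 1) = 1 / y := by
        rw [hr, ← Real.rpow_add hy0, show -δ + (δ - 1) = -1 by ring, Real.rpow_neg_one, one_div]
      rw [hr1]
      -- This is x (1 - x) ≤ 1/4.
      have hx : q * x * (1 - x) / y ≤ q / 4 / y := by
        gcongr
        nlinarith [sq_nonneg (2 * x - 1)]
      have h1 : r * (q * x * (1 - x) / y) ≤ r * (q / 4 / y) := by gcongr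
      have h2 : c / y ≤ r * (q * B * a) := by
        calc c / y = (q * B) * c₀ * (1 / y) := by rw [hc]; ring
          _ = r * (q * B * (c₀ * y ^ (δ - 1))) := by rw [← hr2]; ring
          _ ≤ _ := by gcongr
      have h3 : c / y * ψ y ≤ r * (q * B * a) * ψ y := by gcongr
      have h4 : 0 ≤ δ * (r / y) * ψ y := by positivity
      have h5 : ψ y / y = (c / y * ψ y) / c := by field_simp
      have h6 : q / 4 / (c * δ) * (-δ * (r / y)) = -(r * (q / 4 / y)) / c := by field_simp
      rw [h5, h6, ← add_div, ← add_div]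
      refine div_nonpos_of_nonpos_of_nonneg ?_ hcpos.le
      linarith
  refine ⟨L 1, fun y hy => ?_⟩
  have hy0 : 0 < y := by linarith
  have h1 : L y ≤ L 1 := hLanti (by simp) hy hy
  have hψ0 : 0 < ψ y := h.log_slope_pos hk hkq hE hwE hpE hy0
  have h2 : 0 < y ^ (-δ) * ψ y / c := by positivity
  have h3 : 0 < (q / 4) / (c * δ) * y ^ (-δ) := by positivity
  simp only [hL] at h1 ⊢
  linarith

/-- A global solution has a positive limit of `y ^ (-k) w ^ q` at infinity. -/
theorem exists_limit (h : ProfileODE B q k θ w p (Ioi 0)) (hB : 0 < B) (hq : 1 < q)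
    (hk : 0 < k) (hkq : k < q) (hδ : (θ - 2) * q < k * (q - 1)) (hE : 0 < E)
    (hwE : Tendsto (fun y => w y / y) (𝓝[>] 0) (𝓝 E)) (hpE : Tendsto p (𝓝[>] 0) (𝓝 E)) :
    ∃ A, 0 < A ∧ Tendsto (fun y => y ^ (-k) * w y ^ q) atTop (𝓝 A) := by
  obtain ⟨M, hM⟩ := h.log_quotient_bounded hB hq hk hkq hδ hE hwE hpE
  have hmono := h.log_quotient_mono hk hkq hE hwE hpE
  set g : ℝ → ℝ := fun y => q * Real.log (w y) - k * Real.log y with hg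
  -- Freezing the argument below 1 makes the function monotone on all of ℝ without changing its
  -- limit.
  have hg' : Monotone fun y => g (max 1 y) := fun a b hab =>
    hmono (show (0 : ℝ) < max 1 a by positivity) (show (0 : ℝ) < max 1 b by positivity)
      (max_le_max le_rfl hab)
  have hbdd : BddAbove (range fun y => g (max 1 y)) :=
    ⟨M, by rintro _ ⟨y, rfl⟩; exact hM _ (le_max_left _ _)⟩
  have hlim := tendsto_atTop_ciSup hg' hbdd
  refine ⟨_, Real.exp_pos _, ((Real.continuous_exp.tendsto _).comp hlim).congr' ?_⟩
  filter_upwards [eventually_ge_atTop 1] with y hy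
  have hy0 : 0 < y := by linarith
  simp only [Function.comp, max_eq_right hy, hg]
  rw [Real.rpow_def_of_pos hy0, Real.rpow_def_of_pos (h.pos y hy0), ← Real.exp_add]
  congr 1; ring

end ProfileODE

/-! ### The Volterra operator and its fixed point. -/

/-- The Volterra operator `h ↦ (τ / σ) ∫₀¹ (C - D u ^ (1 / σ)) h (τ u) du`. -/
noncomputable def volterra (σ C D : ℝ) (h : ℝ → ℝ) (τ : ℝ) : ℝ :=
  τ / σ * ∫ u in (0 : ℝ)..1, (C - D * u ^ (1 / σ)) * h (τ * u)

variable {σ C D : ℝ}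

theorem continuous_volterra (hσ : 0 < σ) {h : ℝ → ℝ} (hh : Continuous h) :
    Continuous (volterra σ C D h) := by
  have hr : Continuous fun u : ℝ => u ^ (1 / σ) := Real.continuous_rpow_const (by positivity)
  refine (continuous_id.div_const σ).mul ?_
  refine intervalIntegral.continuous_parametric_intervalIntegral_of_continuous' ?_ 0 1
  exact (continuous_const.sub (continuous_const.mul (hr.comp continuous_snd))).mul
    (hh.comp (continuous_fst.mul continuous_snd))

@[simp] theorem volterra_zero_right {h : ℝ → ℝ} : volterra σ C D h 0 = 0 := by simp [volterra]

@[simp] theorem volterra_zero_fun {τ : ℝ} : volterra σ C D (fun _ => 0) τ = 0 := by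
  simp [volterra]

/-- On [0, 1] the kernel is at most |C| + |D|, and the integral of exp(l τ u) is at most exp(l τ)/(l
τ). The prefactor τ cancels, leaving a gain 1/l in the exponentially weighted norm. -/
theorem abs_volterra_sub_le (hσ : 0 < σ) {l d τ : ℝ} (hl : 0 < l) (hτ : 0 ≤ τ)
    {h₁ h₂ : ℝ → ℝ} (hc₁ : Continuous h₁) (hc₂ : Continuous h₂)
    (hd : ∀ t, 0 ≤ t → |h₁ t - h₂ t| ≤ d * Real.exp (l * t)) :
    |volterra σ C D h₁ τ - volterra σ C D h₂ τ|
      ≤ (|C| + |D|) * d / (σ * l) * Real.exp (l * τ) := by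
  have hr : Continuous fun u : ℝ => u ^ (1 / σ) := Real.continuous_rpow_const (by positivity)
  have hd0 : 0 ≤ d := by simpa using (abs_nonneg _).trans (hd 0 le_rfl)
  rcases hτ.eq_or_lt with rfl | hτ0
  · simp only [volterra_zero_right, sub_self, abs_zero]; positivity
  have hi : ∀ h : ℝ → ℝ, Continuous h → IntervalIntegrable
      (fun u => (C - D * u ^ (1 / σ)) * h (τ * u)) MeasureTheory.volume 0 1 := fun h hh =>
    ((continuous_const.sub (continuous_const.mul hr)).mul
      (hh.comp (continuous_const.mul continuous_id))).intervalIntegrable _ _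
  have hE : Continuous fun u : ℝ => (|C| + |D|) * (d * Real.exp (l * (τ * u))) := by fun_prop
  have hint : ∫ u in (0 : ℝ)..1, (|C| + |D|) * (d * Real.exp (l * (τ * u)))
      = (|C| + |D|) * d / (l * τ) * Real.exp (l * τ) - (|C| + |D|) * d / (l * τ) := by
    have hder : ∀ u ∈ uIcc (0 : ℝ) 1,
        HasDerivAt (fun u => (|C| + |D|) * d / (l * τ) * Real.exp (l * (τ * u)))
          ((|C| + |D|) * (d * Real.exp (l * (τ * u)))) u := by
      intro u _
      refine (((((hasDerivAt_id u).const_mul τ).const_mul l).exp).const_mul _).congr_deriv ?_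
      simp only [id]
      field_simp
    rw [intervalIntegral.integral_eq_sub_of_hasDerivAt hder (hE.intervalIntegrable _ _)]
    simp
  have hle : |∫ u in (0 : ℝ)..1, ((C - D * u ^ (1 / σ)) * h₁ (τ * u)
      - (C - D * u ^ (1 / σ)) * h₂ (τ * u))|
      ≤ ∫ u in (0 : ℝ)..1, (|C| + |D|) * (d * Real.exp (l * (τ * u))) := by
    rw [← Real.norm_eq_abs]
    refine intervalIntegral.norm_integral_le_of_norm_le zero_le_one
      (Eventually.of_forall fun u hu => ?_) (hE.intervalIntegrable _ _)
    have hu1 : u ^ (1 / σ) ≤ 1 := Real.rpow_le_one hu.1.le hu.2 (by positivity)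
    have hu0 : 0 ≤ u ^ (1 / σ) := Real.rpow_nonneg hu.1.le _
    rw [← mul_sub, Real.norm_eq_abs, abs_mul]
    have hK : |C - D * u ^ (1 / σ)| ≤ |C| + |D| := by
      refine (abs_sub _ _).trans (add_le_add le_rfl ?_)
      rw [abs_mul, abs_of_nonneg hu0]
      exact mul_le_of_le_one_right (abs_nonneg _) hu1
    exact mul_le_mul hK (hd _ (mul_nonneg hτ hu.1.le)) (abs_nonneg _) (by positivity)
  rw [volterra, volterra, ← mul_sub, ← intervalIntegral.integral_sub (hi _ hc₁) (hi _ hc₂),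
    abs_mul, abs_of_pos (by positivity : 0 < τ / σ)]
  calc _ ≤ τ / σ * ((|C| + |D|) * d / (l * τ) * Real.exp (l * τ)) := by
        gcongr
        refine hle.trans ?_
        rw [hint]
        have : 0 ≤ (|C| + |D|) * d / (l * τ) := by positivity
        linarith
    _ = _ := by field_simp

/-- Global unique solvability of the Volterra equation with a bounded Lipschitz nonlinearity. -/
theorem existsUnique_volterra (hσ : 0 < σ) (E : ℝ) {N : ℝ → ℝ} {L M : ℝ}
    (hL : ∀ a b, |N a - N b| ≤ L * |a - b|) (hM : ∀ a, |N a| ≤ M) :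
    ∃! z : ℝ → ℝ, Continuous z ∧ ∀ τ, z τ = E + volterra σ C D (N ∘ z) |τ| := by
  have hL0 : 0 ≤ L := by simpa using (abs_nonneg _).trans (hL 1 0)
  have hM0 : 0 ≤ M := (abs_nonneg _).trans (hM 0)
  have hNc : Continuous N := (LipschitzWith.of_dist_le_mul (K := L.toNNReal) fun a b => by
    rw [Real.coe_toNNReal _ hL0]; exact hL a b).continuous
  -- Chosen so that (|C| + |D|) L / (σ l) ≤ 1/2; the summand 1 keeps l positive in degenerate cases.
  set l : ℝ := 2 * (|C| + |D|) * L / σ + 1 with hldef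
  have hl : 0 < l := by positivity
  have hgrow : ∀ z : ℝ → ℝ, Continuous z → ∀ τ : ℝ,
      |E + volterra σ C D (N ∘ z) (|τ|)| ≤ (|E| + (|C| + |D|) * M / (σ * l)) * Real.exp (l * |τ|) := by
    intro z hz τ
    have h1 := abs_volterra_sub_le (C := C) (D := D) hσ hl (abs_nonneg τ) (hNc.comp hz)
      (continuous_const (y := (0 : ℝ))) (d := M) (fun t ht => by
        rw [sub_zero]
        exact (hM _).trans (le_mul_of_one_le_right hM0 (Real.one_le_exp (by positivity))))
    rw [volterra_zero_fun, sub_zero] at h1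
    refine (abs_add_le _ _).trans ?_
    rw [add_mul]
    refine add_le_add ?_ h1
    exact le_mul_of_one_le_right (abs_nonneg E) (Real.one_le_exp (by positivity))
  have hexp : Continuous fun τ : ℝ => Real.exp (l * |τ|) := by fun_prop
  have hexpn : Continuous fun τ : ℝ => Real.exp (-(l * |τ|)) := by fun_prop
  -- The contraction acts on ζ = exp(-l|τ|) z, which is bounded even when z grows. Using |τ| extends
  -- the equation evenly to the whole line.
  let lift : BoundedContinuousFunction ℝ ℝ → ℝ → ℝ := fun ζ t => Real.exp (l * |t|) * ζ t
  have hlift : ∀ ζ, Continuous (lift ζ) := fun ζ => hexp.mul ζ.continuous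
  let T : BoundedContinuousFunction ℝ ℝ → BoundedContinuousFunction ℝ ℝ := fun ζ =>
    BoundedContinuousFunction.ofNormedAddCommGroup
      (fun τ => Real.exp (-(l * |τ|)) * (E + volterra σ C D (N ∘ lift ζ) |τ|))
      (hexpn.mul (continuous_const.add
        ((continuous_volterra hσ (hNc.comp (hlift ζ))).comp continuous_abs)))
      (|E| + (|C| + |D|) * M / (σ * l))
      (fun τ => by
        rw [Real.norm_eq_abs, abs_mul, abs_of_pos (Real.exp_pos _), Real.exp_neg,
          inv_mul_le_iff₀ (Real.exp_pos _), mul_comm]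
        exact hgrow _ (hlift ζ) τ)
  have hTapp : ∀ ζ τ, T ζ τ = Real.exp (-(l * |τ|)) * (E + volterra σ C D (N ∘ lift ζ) |τ|) :=
    fun _ _ => rfl
  have hT : ContractingWith (1 / 2) T := by
    refine ⟨by rw [← NNReal.coe_lt_coe]; norm_num, LipschitzWith.of_dist_le_mul fun ζ₁ ζ₂ => ?_⟩
    refine (BoundedContinuousFunction.dist_le (by positivity)).2 fun τ => ?_
    have h1 := abs_volterra_sub_le (C := C) (D := D) hσ hl (abs_nonneg τ)
      (hNc.comp (hlift ζ₁)) (hNc.comp (hlift ζ₂)) (d := L * dist ζ₁ ζ₂) (fun t ht => by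
        refine (hL _ _).trans ?_
        simp only [lift]
        rw [← mul_sub, abs_mul, abs_of_pos (Real.exp_pos _), abs_of_nonneg ht, mul_assoc,
          mul_comm (dist ζ₁ ζ₂)]
        gcongr
        exact (Real.dist_eq _ _).symm.trans_le (BoundedContinuousFunction.dist_coe_le_dist t))
    rw [Real.dist_eq, hTapp, hTapp, ← mul_sub, abs_mul, abs_of_pos (Real.exp_pos _), Real.exp_neg,
      inv_mul_le_iff₀ (Real.exp_pos _), add_sub_add_left_eq_sub, mul_comm]
    refine h1.trans ?_
    gcongr
    rw [div_le_iff₀ (by positivity)]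
    have hk : 2 * ((|C| + |D|) * L) ≤ σ * l := by
      rw [hldef]; field_simp; linarith
    have := mul_le_mul_of_nonneg_right hk (dist_nonneg (x := ζ₁) (y := ζ₂))
    simp only [one_div, NNReal.coe_inv, NNReal.coe_ofNat]
    linarith
  have hee : ∀ τ : ℝ, Real.exp (l * |τ|) * Real.exp (-(l * |τ|)) = 1 := fun τ => by
    rw [← Real.exp_add]; simp
  refine ⟨lift (hT.fixedPoint T), ⟨hlift _, fun τ => ?_⟩, ?_⟩
  · have h1 := congrArg (fun ζ => ζ τ) (hT.fixedPoint_isFixedPt).symm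
    simp only [hTapp] at h1
    show Real.exp (l * |τ|) * _ = _
    rw [h1, ← mul_assoc, hee, one_mul]
  · rintro z ⟨hz, hzeq⟩
    -- Since the nonlinearity is bounded, any continuous solution satisfies the growth bound, so its
    -- weighted version lies in the space; no growth assumption is needed for uniqueness.
    let ζ : BoundedContinuousFunction ℝ ℝ := BoundedContinuousFunction.ofNormedAddCommGroup
      (fun τ => Real.exp (-(l * |τ|)) * z τ) (hexpn.mul hz) (|E| + (|C| + |D|) * M / (σ * l))
      (fun τ => by
        rw [Real.norm_eq_abs, abs_mul, abs_of_pos (Real.exp_pos _), Real.exp_neg,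
          inv_mul_le_iff₀ (Real.exp_pos _), mul_comm, hzeq]
        exact hgrow _ hz τ)
    have hζ : lift ζ = z := by
      funext τ
      show Real.exp (l * |τ|) * (Real.exp (-(l * |τ|)) * z τ) = z τ
      rw [← mul_assoc, hee, one_mul]
    have hfix : Function.IsFixedPt T ζ := by
      ext τ
      rw [hTapp, hζ, ← hzeq]; rfl
    rw [← hT.fixedPoint_unique hfix, hζ]

/-! ### The Volterra equation as the twice integrated profile equation. -/

/-- Substituting t = τ u with τ = y^σ moves y out of the integrands, leaving integrals that depend
on y only through a factor and the upper limit. In this form the operator can be differentiated by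
the fundamental theorem of calculus. -/
theorem mul_volterra_rpow {σ C D : ℝ} (hσ : 0 < σ) {h : ℝ → ℝ} (hh : Continuous h) {y : ℝ}
    (hy : 0 < y) :
    y * volterra σ C D h (y ^ σ) = C / σ * (y * ∫ t in (0 : ℝ)..y ^ σ, h t)
      - D / σ * ∫ t in (0 : ℝ)..y ^ σ, t ^ (1 / σ) * h t := by
  have hτ : 0 < y ^ σ := by positivity
  have hroot : (y ^ σ) ^ (1 / σ) = y := by
    rw [← Real.rpow_mul hy.le, mul_one_div_cancel hσ.ne', Real.rpow_one]
  set τ := y ^ σ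
  have hr : Continuous fun u : ℝ => u ^ (1 / σ) := Real.continuous_rpow_const (by positivity)
  have h1 := intervalIntegral.smul_integral_comp_mul_left (a := 0) (b := 1)
    (fun t => (C - D * (t / τ) ^ (1 / σ)) * h t) τ
  simp only [mul_zero, mul_one, smul_eq_mul, mul_div_cancel_left₀ _ hτ.ne'] at h1
  have h2 : ∫ t in (0 : ℝ)..τ, (C - D * (t / τ) ^ (1 / σ)) * h t
      = ∫ t in (0 : ℝ)..τ, (C * h t - D / y * (t ^ (1 / σ) * h t)) := by
    refine intervalIntegral.integral_congr fun t ht => ?_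
    rw [uIcc_of_le hτ.le] at ht
    rw [Real.div_rpow ht.1 hτ.le, hroot]
    ring
  have hi₁ : Continuous fun t => C * h t := continuous_const.mul hh
  have hi₂ : Continuous fun t => D / y * (t ^ (1 / σ) * h t) := continuous_const.mul (hr.mul hh)
  rw [h2, intervalIntegral.integral_sub (hi₁.intervalIntegrable _ _) (hi₂.intervalIntegrable _ _),
    intervalIntegral.integral_const_mul, intervalIntegral.integral_const_mul] at h1
  rw [volterra, div_mul_eq_mul_div, h1]
  field_simp

theorem hasDerivAt_integral_rpow {σ : ℝ} {h : ℝ → ℝ} (hh : Continuous h) {y : ℝ} (hy : 0 < y) :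
    HasDerivAt (fun y : ℝ => ∫ t in (0 : ℝ)..y ^ σ, h t) (h (y ^ σ) * (σ * y ^ (σ - 1))) y :=
  HasDerivAt.comp y (h₂ := fun u => ∫ t in (0 : ℝ)..u, h t)
    (hh.integral_hasStrictDerivAt 0 (y ^ σ)).hasDerivAt
    (Real.hasDerivAt_rpow_const (Or.inl hy.ne'))

theorem hasDerivAt_mul_volterra {σ C D c : ℝ} (hσ : 0 < σ) {h : ℝ → ℝ} (hh : Continuous h) {y : ℝ}
    (hy : 0 < y) :
    HasDerivAt (fun y => y * (c + volterra σ C D h (y ^ σ)))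
      (c + (C / σ * (∫ t in (0 : ℝ)..y ^ σ, h t) - (D - C) * (y ^ σ * h (y ^ σ)))) y := by
  have hr : Continuous fun u : ℝ => u ^ (1 / σ) := Real.continuous_rpow_const (by positivity)
  have hev : (fun y => y * (c + volterra σ C D h (y ^ σ))) =ᶠ[𝓝 y]
      fun y => y * c + (C / σ * (y * ∫ t in (0 : ℝ)..y ^ σ, h t)
      - D / σ * ∫ t in (0 : ℝ)..y ^ σ, t ^ (1 / σ) * h t) := by
    filter_upwards [lt_mem_nhds hy] with x hx
    rw [mul_add, mul_volterra_rpow hσ hh hx]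
  refine HasDerivAt.congr_of_eventuallyEq ?_ hev
  have hroot : (y ^ σ) ^ (1 / σ) = y := by
    rw [← Real.rpow_mul hy.le, mul_one_div_cancel hσ.ne', Real.rpow_one]
  refine (((hasDerivAt_id y).mul_const c).add
    ((((hasDerivAt_id y).mul (hasDerivAt_integral_rpow hh hy)).const_mul _).sub
      ((hasDerivAt_integral_rpow (hr.mul hh) hy).const_mul _))).congr_deriv ?_
  simp only [id, hroot, Real.rpow_sub_one hy.ne', Pi.mul_apply]
  field_simp
  ring

theorem rpow_mul_div_rpow {θ q σ w y : ℝ} (hσ : σ = q - θ + 1) (hy : 0 < y) (hw : 0 < w) :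
    y ^ σ * (w / y) ^ q = y ^ (1 - θ) * w ^ q := by
  rw [Real.div_rpow hw.le hy.le, hσ, show q - θ + 1 = (1 - θ) + q by ring, Real.rpow_add hy]
  field_simp

/-- The derivative of the right-hand side of the once integrated profile equation. -/
theorem hasDerivAt_integrated {B q k θ σ w' y : ℝ} (hσdef : σ = q - θ + 1) (hσ : 0 < σ)
    {w h : ℝ → ℝ} (hh : Continuous h) (hy : 0 < y) (hw : 0 < w y) (hwd : HasDerivAt w w' y)
    (hhy : h (y ^ σ) = (w y / y) ^ q) :
    HasDerivAt (fun y => B * (1 + k - θ) / σ * (∫ t in (0 : ℝ)..y ^ σ, h t)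
        - B * (y ^ (1 - θ) * w y ^ q))
      (B * y ^ (-θ) * (k * w y ^ q - q * y * w y ^ (q - 1) * w')) y := by
  refine (((hasDerivAt_integral_rpow hh hy).const_mul _).sub
    (((Real.hasDerivAt_rpow_const (p := 1 - θ) (Or.inl hy.ne')).mul
      (hwd.rpow_const (p := q) (Or.inl hw.ne'))).const_mul B)).congr_deriv ?_
  have h1 : h (y ^ σ) * (σ * y ^ (σ - 1)) = σ * (y ^ (-θ) * w y ^ q) := by
    have h2 := rpow_mul_div_rpow hσdef hy hw
    have h3 : y ^ (1 - θ) = y * y ^ (-θ) := by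
      rw [sub_eq_add_neg, Real.rpow_add hy, Real.rpow_one]
    rw [hhy, Real.rpow_sub_one hy.ne']
    rw [h3] at h2
    field_simp
    linarith
  have h3 : y ^ (1 - θ) = y * y ^ (-θ) := by
    rw [sub_eq_add_neg, Real.rpow_add hy, Real.rpow_one]
  rw [h1, show (1 - θ - 1) = -θ by ring, h3]
  field_simp
  ring

theorem tendsto_rpow_zero_right {σ : ℝ} (hσ : 0 < σ) :
    Tendsto (fun y : ℝ => y ^ σ) (𝓝[>] 0) (𝓝 0) := by
  have := (Real.continuous_rpow_const (q := σ) hσ.le).tendsto 0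
  rw [Real.zero_rpow hσ.ne'] at this
  exact this.mono_left nhdsWithin_le_nhds

/-! ### Existence and uniqueness for a prescribed slope at the origin. -/

/-- The truncated power `a ↦ (min (a⁺) (2E)) ^ q`. -/
noncomputable def truncPow (q E a : ℝ) : ℝ := (max 0 (min a (2 * E))) ^ q

theorem truncPow_eq {q E a : ℝ} (h0 : 0 ≤ a) (h1 : a ≤ 2 * E) : truncPow q E a = a ^ q := by
  rw [truncPow, min_eq_left h1, max_eq_right h0]

theorem abs_truncPow_le {q E : ℝ} (hq : 1 < q) (hE : 0 < E) (a : ℝ) :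
    |truncPow q E a| ≤ (2 * E) ^ q := by
  have h0 : 0 ≤ max 0 (min a (2 * E)) := le_max_left _ _
  rw [truncPow, abs_of_nonneg (Real.rpow_nonneg h0 _)]
  exact Real.rpow_le_rpow h0 (max_le (by positivity) (min_le_right _ _)) (by linarith)

theorem abs_truncPow_sub_le {q E : ℝ} (hq : 1 < q) (hE : 0 < E) (a b : ℝ) :
    |truncPow q E a - truncPow q E b| ≤ q * (2 * E) ^ (q - 1) * |a - b| := by
  have hmem : ∀ x : ℝ, max 0 (min x (2 * E)) ∈ Icc 0 (2 * E) := fun x =>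
    ⟨le_max_left _ _, max_le (by positivity) (min_le_right _ _)⟩
  have h1 := Convex.norm_image_sub_le_of_norm_hasDerivWithin_le (s := Icc 0 (2 * E))
    (f := fun x : ℝ => x ^ q) (f' := fun x => q * x ^ (q - 1)) (C := q * (2 * E) ^ (q - 1))
    (fun x _ => (Real.hasDerivAt_rpow_const (Or.inr hq.le)).hasDerivWithinAt)
    (fun x hx => by
      have h3 : 0 ≤ x ^ (q - 1) := Real.rpow_nonneg hx.1 _
      rw [Real.norm_eq_abs, abs_of_nonneg (by positivity)]
      exact mul_le_mul_of_nonneg_left (Real.rpow_le_rpow hx.1 hx.2 (by linarith)) (by linarith))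
    (convex_Icc _ _) (hmem b) (hmem a)
  refine h1.trans ?_
  gcongr
  refine (abs_max_sub_max_le_max _ _ _ _).trans ?_
  rw [sub_self, abs_zero, max_eq_right (abs_nonneg _)]
  refine (abs_min_sub_min_le_max _ _ _ _).trans ?_
  rw [sub_self, abs_zero, max_eq_left (abs_nonneg _)]

section Local

variable {B q k θ σ E : ℝ}

theorem tendsto_integrated {c a : ℝ} (hσ : 0 < σ) {h : ℝ → ℝ} (hh : Continuous h) :
    Tendsto (fun y : ℝ => c + (a * (∫ t in (0 : ℝ)..y ^ σ, h t) - B * (y ^ σ * h (y ^ σ))))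
      (𝓝[>] 0) (𝓝 c) := by
  have hQ : Continuous fun τ : ℝ => c + (a * (∫ t in (0 : ℝ)..τ, h t) - B * (τ * h τ)) := by
    refine continuous_const.add ((continuous_const.mul ?_).sub
      (continuous_const.mul (continuous_id.mul hh)))
    exact continuous_iff_continuousAt.2 fun τ =>
      (hh.integral_hasStrictDerivAt 0 τ).hasDerivAt.continuousAt
  have := (hQ.tendsto 0).comp (tendsto_rpow_zero_right hσ)
  simpa [Function.comp_def] using this

/-- A solution of the profile equation on `(0, ∞)` with prescribed slope at the origin. -/
theorem exists_profile (hB : 0 < B) (hq : 1 < q) (hk : 0 < k) (hkq : k < q)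
    (hσdef : σ = q - θ + 1) (hσ : 0 < σ) (hE : 0 < E) :
    ∃ w p : ℝ → ℝ, ProfileODE B q k θ w p (Ioi 0) ∧
      Tendsto (fun y => w y / y) (𝓝[>] 0) (𝓝 E) ∧ Tendsto p (𝓝[>] 0) (𝓝 E) := by
  -- Writing the right-hand side as C y^(-θ) w^q - B (y^(1-θ) w^q)' gives this C; a second
  -- integration gives the other kernel coefficient B + C.
  set C := B * (1 + k - θ) with hC
  set N := truncPow q E with hN
  obtain ⟨z, ⟨hz, hzeq⟩, -⟩ := existsUnique_volterra (C := C) (D := B + C) hσ E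
    (abs_truncPow_sub_le hq hE) (abs_truncPow_le hq hE)
  have hNc : Continuous N :=
    ((continuous_const.max (continuous_id.min continuous_const)).rpow_const
      fun _ => Or.inr (by linarith))
  set h := N ∘ z with hh
  have hhc : Continuous h := hNc.comp hz
  have hz0 : z 0 = E := by rw [hzeq]; simp
  set w : ℝ → ℝ := fun y => y * z (y ^ σ) with hw
  set p : ℝ → ℝ := fun y => E + (C / σ * (∫ t in (0 : ℝ)..y ^ σ, h t)
    - B * (y ^ σ * h (y ^ σ))) with hp
  have hwp : ∀ y, 0 < y → HasDerivAt w (p y) y := by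
    intro y hy
    have h1 := hasDerivAt_mul_volterra (C := C) (D := B + C) (c := E) hσ hhc hy
    rw [add_sub_cancel_right] at h1
    refine h1.congr_of_eventuallyEq ?_
    filter_upwards [lt_mem_nhds hy] with x hx
    rw [hw]
    simp only
    rw [hzeq, abs_of_nonneg (by positivity)]
  have hσc : Continuous fun y : ℝ => y ^ σ := Real.continuous_rpow_const hσ.le
  have hzc : Continuous fun y : ℝ => z (y ^ σ) := hz.comp hσc
  have hwE : Tendsto (fun y => w y / y) (𝓝[>] 0) (𝓝 E) := by
    have h1 := (hz.tendsto 0).comp (tendsto_rpow_zero_right hσ)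
    rw [hz0] at h1
    refine h1.congr' ?_
    filter_upwards [self_mem_nhdsWithin] with y hy
    have : (0 : ℝ) < y := hy
    simp only [hw, Function.comp]
    field_simp
  have hpE : Tendsto p (𝓝[>] 0) (𝓝 E) := tendsto_integrated hσ hhc
  have hsol : ∀ s : Set ℝ, s ⊆ Ioi 0 → (∀ y ∈ s, z (y ^ σ) ∈ Ioo 0 (2 * E)) →
      ProfileODE B q k θ w p s := by
    intro s hs hsz
    refine ⟨fun y hy => mul_pos (hs hy) (hsz y hy).1, fun y hy => hwp y (hs hy), fun y hy => ?_⟩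
    have hy0 : 0 < y := hs hy
    have hwz : ∀ x : ℝ, 0 < x → z (x ^ σ) = w x / x := fun x hx => by
      simp only [hw]; field_simp
    have hheq : ∀ x : ℝ, 0 < x → z (x ^ σ) ∈ Ioo 0 (2 * E) → h (x ^ σ) = (w x / x) ^ q :=
      fun x hx hxz => by
        rw [← hwz x hx, hh, Function.comp, hN, truncPow_eq hxz.1.le hxz.2.le]
    have h1 := (hasDerivAt_integrated (B := B) (k := k) hσdef hσ hhc hy0
      (show 0 < w y from mul_pos hy0 (hsz y hy).1) (hwp y hy0) (hheq y hy0 (hsz y hy))).const_add E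
    refine h1.congr_of_eventuallyEq ?_
    filter_upwards [lt_mem_nhds hy0,
      hzc.continuousAt.eventually (isOpen_Ioo.mem_nhds (hsz y hy))] with x hx hxz
    simp only [hp]
    rw [hheq x hx hxz, rpow_mul_div_rpow hσdef hx (mul_pos hx hxz.1)]
  have hall : ∀ y, 0 < y → z (y ^ σ) ∈ Ioo 0 (2 * E) := by
    by_contra! hne
    obtain ⟨b, hb0, hb⟩ := hne
    -- Its infimum is the first point at which z leaves (0, 2E); it is positive because z(0) = E.
    set S : Set ℝ := {y | 0 ≤ y ∧ z (y ^ σ) ∉ Ioo 0 (2 * E)} with hS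
    have hScl : IsClosed S := by
      have h1 : IsClosed {y : ℝ | z (y ^ σ) ∉ Ioo 0 (2 * E)} :=
        isOpen_Ioo.isClosed_compl.preimage hzc
      exact (isClosed_Ici (a := (0 : ℝ))).inter h1
    have hSbdd : BddBelow S := ⟨0, fun y hy => hy.1⟩
    have hmem : sInf S ∈ S := hScl.csInf_mem ⟨b, hb0.le, hb⟩ hSbdd
    set y₁ := sInf S
    have hy₁ : 0 < y₁ := by
      refine lt_of_le_of_ne hmem.1 fun h0 => hmem.2 ?_
      rw [← h0, Real.zero_rpow hσ.ne', hz0]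
      exact ⟨hE, by linarith⟩
    have hI : ∀ y ∈ Ioo 0 y₁, z (y ^ σ) ∈ Ioo 0 (2 * E) := fun y hy => by
      by_contra hc
      exact absurd (csInf_le hSbdd ⟨hy.1.le, hc⟩) (not_le.2 hy.2)
    have hode := hsol (Ioo 0 y₁) (fun y hy => hy.1) hI
    -- Before the exit the true equation holds. Monotonicity of w excludes z = 0 at the exit, and w
    -- ≤ E y gives z ≤ E, strictly below the truncation level 2E.
    refine hmem.2 ⟨?_, ?_⟩
    · have hmono := hode.fst_strictMonoOn hk hkq hE hwE hpE
      have hhalf : y₁ / 2 ∈ Ioo 0 y₁ := ⟨by linarith, by linarith⟩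
      have hle : w (y₁ / 2) ≤ w y₁ := by
        refine ge_of_tendsto ((hwp y₁ hy₁).continuousAt.tendsto.mono_left nhdsWithin_le_nhds :
          Tendsto w (𝓝[<] y₁) (𝓝 (w y₁))) ?_
        filter_upwards [Ioo_mem_nhdsLT hhalf.2] with x hx
        exact hmono.monotoneOn hhalf ⟨hhalf.1.trans hx.1, hx.2⟩ hx.1.le
      exact pos_of_mul_pos_right ((hode.pos _ hhalf).trans_le hle) hy₁.le
    · have hle : w y₁ ≤ E * y₁ := by
        refine le_of_tendsto_of_tendsto
          ((hwp y₁ hy₁).continuousAt.tendsto.mono_left nhdsWithin_le_nhds :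
            Tendsto w (𝓝[<] y₁) (𝓝 (w y₁)))
          ((continuous_const.mul continuous_id).continuousAt.tendsto.mono_left
            nhdsWithin_le_nhds : Tendsto (fun y => E * y) (𝓝[<] y₁) (𝓝 (E * y₁))) ?_
        filter_upwards [Ioo_mem_nhdsLT hy₁] with x hx
        exact hode.fst_le hB hk hkq hE hwE hpE hx
      have : z (y₁ ^ σ) ≤ E := by
        have h2 : y₁ * z (y₁ ^ σ) ≤ y₁ * E := by simpa only [hw, mul_comm E] using hle
        exact le_of_mul_le_mul_left h2 hy₁
      linarith
  exact ⟨w, p, hsol _ subset_rfl hall, hwE, hpE⟩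

/-- A solution of the profile equation with `w y / y → E` has a `C¹` extension to the origin and
is represented by the Volterra operator. -/
theorem ProfileODE.exists_volterra {w p : ℝ → ℝ} (h : ProfileODE B q k θ w p (Ioi 0))
    (hq : 1 < q) (hσdef : σ = q - θ + 1) (hσ : 0 < σ)
    (hwE : Tendsto (fun y => w y / y) (𝓝[>] 0) (𝓝 E)) :
    Tendsto p (𝓝[>] 0) (𝓝 E) ∧ ∃ z : ℝ → ℝ, Continuous z ∧ z 0 = E ∧
      (∀ y, 0 < y → z (y ^ σ) = w y / y) ∧ (∀ τ, z τ = z |τ|) ∧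
      ∀ τ, z τ = E + volterra σ (B * (1 + k - θ)) (B + B * (1 + k - θ)) (fun t => z t ^ q) |τ| := by
  set C := B * (1 + k - θ) with hC
  -- The quotient w/y read in the variable τ = y^σ and extended evenly; its value at 0 is then set
  -- to the limit E.
  set g : ℝ → ℝ := fun τ => w (|τ| ^ (1 / σ)) / |τ| ^ (1 / σ) with hg
  set z : ℝ → ℝ := Function.update g 0 E with hz
  have hz0 : z 0 = E := by simp [hz]
  have hzne : ∀ τ, τ ≠ 0 → z τ = g τ := fun τ hτ => by simp [hz, hτ]
  have hrootc : Continuous fun τ : ℝ => |τ| ^ (1 / σ) :=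
    (Real.continuous_rpow_const (by positivity)).comp continuous_abs
  have hzc : Continuous z := by
    refine continuous_iff_continuousAt.2 fun τ => ?_
    rcases eq_or_ne τ 0 with rfl | hτ
    · refine continuousAt_update_same.2 ?_
      refine hwE.comp (f := fun τ : ℝ => |τ| ^ (1 / σ)) (tendsto_nhdsWithin_iff.2 ⟨?_, ?_⟩)
      · have := hrootc.tendsto 0
        rw [abs_zero, Real.zero_rpow (by positivity)] at this
        exact this.mono_left nhdsWithin_le_nhds
      · filter_upwards [self_mem_nhdsWithin] with τ hτ
        exact Real.rpow_pos_of_pos (abs_pos.2 hτ) _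
    · have hpos : 0 < |τ| ^ (1 / σ) := Real.rpow_pos_of_pos (abs_pos.2 hτ) _
      have hgc : ContinuousAt g τ := by
        refine ContinuousAt.div (ContinuousAt.comp (g := w) (f := fun τ : ℝ => |τ| ^ (1 / σ))
          (h.deriv_fst _ hpos).continuousAt
          hrootc.continuousAt) hrootc.continuousAt hpos.ne'
      refine hgc.congr ?_
      filter_upwards [isOpen_ne.mem_nhds hτ] with x hx
      exact (hzne x hx).symm
  have hzw : ∀ y, 0 < y → z (y ^ σ) = w y / y := fun y hy => by
    have hy' : 0 < y ^ σ := by positivity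
    rw [hzne _ hy'.ne', hg]
    simp only
    rw [abs_of_pos hy', ← Real.rpow_mul hy.le, mul_one_div_cancel hσ.ne', Real.rpow_one]
  have hzabs : ∀ τ, z τ = z |τ| := fun τ => by
    rcases eq_or_ne τ 0 with rfl | hτ
    · simp
    · rw [hzne τ hτ, hzne _ (abs_pos.2 hτ).ne']
      simp only [hg, abs_abs]
  set H : ℝ → ℝ := fun t => z t ^ q with hH
  have hHc : Continuous H := hzc.rpow_const fun _ => Or.inr (by linarith)
  have hHw : ∀ y, 0 < y → H (y ^ σ) = (w y / y) ^ q := fun y hy => by simp only [hH, hzw y hy]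
  have hHw' : ∀ y, 0 < y → y ^ σ * H (y ^ σ) = y ^ (1 - θ) * w y ^ q := fun y hy => by
    rw [hHw y hy, rpow_mul_div_rpow hσdef hy (h.pos y hy)]
  -- Two integrations produce constants c and d. The convergence of p is not assumed; it follows
  -- once c has been identified with E.
  have hd1 : ∀ y, 0 < y → HasDerivAt (fun y => p y - (C / σ * (∫ t in (0 : ℝ)..y ^ σ, H t)
        - B * (y ^ (1 - θ) * w y ^ q))) 0 y := fun y hy =>
    ((h.deriv_snd y hy).sub (hasDerivAt_integrated (B := B) (k := k) hσdef hσ hHc hy (h.pos y hy)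
      (h.deriv_fst y hy) (hHw y hy))).congr_deriv (sub_self _)
  obtain ⟨c, hc⟩ := isOpen_Ioi.exists_is_const_of_deriv_eq_zero (isPreconnected_Ioi (a := (0 : ℝ)))
    (fun y hy => (hd1 y hy).differentiableAt.differentiableWithinAt)
    (fun y hy => (hd1 y hy).deriv)
  have hpc : ∀ y, 0 < y → p y = c + (C / σ * (∫ t in (0 : ℝ)..y ^ σ, H t)
      - B * (y ^ σ * H (y ^ σ))) := fun y hy => by
    have := hc y hy
    rw [hHw' y hy]
    linarith
  have hd2 : ∀ y, 0 < y → HasDerivAt (fun y => w y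
      - y * (c + volterra σ C (B + C) H (y ^ σ))) 0 y := fun y hy => by
    refine ((h.deriv_fst y hy).sub (hasDerivAt_mul_volterra hσ hHc hy)).congr_deriv ?_
    rw [hpc y hy, add_sub_cancel_right, sub_self]
  obtain ⟨d, hd⟩ := isOpen_Ioi.exists_is_const_of_deriv_eq_zero (isPreconnected_Ioi (a := (0 : ℝ)))
    (fun y hy => (hd2 y hy).differentiableAt.differentiableWithinAt)
    (fun y hy => (hd2 y hy).deriv)
  have hV : Tendsto (fun y : ℝ => c + volterra σ C (B + C) H (y ^ σ)) (𝓝[>] 0) (𝓝 c) := by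
    have := ((continuous_const (y := c)).add (continuous_volterra (C := C) (D := B + C) hσ hHc)).tendsto 0
    have := this.comp (tendsto_rpow_zero_right hσ)
    simpa [Function.comp_def] using this
  -- Both w and y (c + V) tend to 0 at the origin, where V is the Volterra term; dividing by y
  -- afterwards yields c = E.
  have hd0 : d = 0 := by
    have h1 : Tendsto (fun y : ℝ => y) (𝓝[>] 0) (𝓝 0) := nhdsWithin_le_nhds
    have h2 := (ProfileODE.tendsto_fst_zero hwE).sub (h1.mul hV)
    rw [zero_mul, sub_zero] at h2
    refine tendsto_nhds_unique (tendsto_const_nhds.congr' ?_) h2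
    filter_upwards [self_mem_nhdsWithin] with y hy
    exact (hd y hy).symm
  have hwV : ∀ y, 0 < y → w y / y = c + volterra σ C (B + C) H (y ^ σ) := fun y hy => by
    have := hd y hy
    rw [hd0, sub_eq_zero] at this
    rw [this]; field_simp
  have hcE : c = E := by
    refine tendsto_nhds_unique (hV.congr' ?_) hwE
    filter_upwards [self_mem_nhdsWithin] with y hy
    exact (hwV y hy).symm
  subst hcE
  refine ⟨(tendsto_integrated (B := B) (a := C / σ) hσ hHc).congr' ?_, z, hzc, hz0, hzw, hzabs, fun τ => ?_⟩
  · filter_upwards [self_mem_nhdsWithin] with y hy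
    exact (hpc y hy).symm
  · rcases eq_or_ne τ 0 with rfl | hτ
    · simp [hz0]
    · have hpos : 0 < |τ| ^ (1 / σ) := Real.rpow_pos_of_pos (abs_pos.2 hτ) _
      have hpow : (|τ| ^ (1 / σ)) ^ σ = |τ| := by
        rw [← Real.rpow_mul (abs_nonneg _), one_div_mul_cancel hσ.ne', Real.rpow_one]
      have h1 := hwV _ hpos
      rw [← hzw _ hpos, hpow] at h1
      rw [hzabs, h1]

/-- The slope at the origin determines the solution. -/
theorem ProfileODE.eqOn_of_slope {w₁ p₁ w₂ p₂ : ℝ → ℝ} (h₁ : ProfileODE B q k θ w₁ p₁ (Ioi 0))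
    (h₂ : ProfileODE B q k θ w₂ p₂ (Ioi 0)) (hB : 0 < B) (hq : 1 < q) (hk : 0 < k) (hkq : k < q)
    (hσdef : σ = q - θ + 1) (hσ : 0 < σ) (hE : 0 < E)
    (hE₁ : Tendsto (fun y => w₁ y / y) (𝓝[>] 0) (𝓝 E))
    (hE₂ : Tendsto (fun y => w₂ y / y) (𝓝[>] 0) (𝓝 E)) : EqOn w₁ w₂ (Ioi 0) := by
  have key : ∀ w p, ProfileODE B q k θ w p (Ioi 0) →
      Tendsto (fun y => w y / y) (𝓝[>] 0) (𝓝 E) →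
      ∃ z : ℝ → ℝ, (Continuous z ∧ ∀ τ, z τ = E + volterra σ (B * (1 + k - θ))
        (B + B * (1 + k - θ)) (truncPow q E ∘ z) |τ|) ∧ ∀ y, 0 < y → z (y ^ σ) = w y / y := by
    intro w p h hwE
    obtain ⟨hpE, z, hzc, hz0, hzw, hzabs, hzeq⟩ := h.exists_volterra hq hσdef hσ hwE
    refine ⟨z, ⟨hzc, fun τ => ?_⟩, hzw⟩
    -- The a priori bound gives 0 < z ≤ E, so z also solves the truncated equation, for which
    -- uniqueness is known.
    have hrange : ∀ t, truncPow q E (z t) = z t ^ q := by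
      intro t
      rcases eq_or_ne t 0 with rfl | ht
      · rw [hz0, truncPow_eq hE.le (by linarith)]
      · have hpos : 0 < |t| ^ (1 / σ) := Real.rpow_pos_of_pos (abs_pos.2 ht) _
        have hpow : (|t| ^ (1 / σ)) ^ σ = |t| := by
          rw [← Real.rpow_mul (abs_nonneg _), one_div_mul_cancel hσ.ne', Real.rpow_one]
        have h1 := hzw _ hpos
        rw [hpow, ← hzabs] at h1
        have hw := h.pos _ hpos
        have hle := (h.mono (show Ioo 0 (|t| ^ (1 / σ) + 1) ⊆ Ioi 0 from
          Ioo_subset_Ioi_self)).fst_le hB hk hkq hE hwE hpE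
          (y := |t| ^ (1 / σ)) ⟨hpos, by linarith⟩
        have h2 : z t ≤ E := by rw [h1, div_le_iff₀ hpos]; exact hle
        exact truncPow_eq (by rw [h1]; positivity) (by linarith)
    rw [hzeq]
    congr 2
    funext t
    exact (hrange t).symm
  obtain ⟨z₁, hz₁, hw₁⟩ := key w₁ p₁ h₁ hE₁
  obtain ⟨z₂, hz₂, hw₂⟩ := key w₂ p₂ h₂ hE₂
  have hz := (existsUnique_volterra hσ E (abs_truncPow_sub_le hq hE)
    (abs_truncPow_le hq hE)).unique hz₁ hz₂
  intro y hy
  have hy0 : (0 : ℝ) < y := hy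
  have := hw₁ y hy
  rw [hz, hw₂ y hy] at this
  field_simp at this
  exact this.symm

end Local

/-! ### Scaling: from the slope at 0 to the limit at infinity. -/

namespace ProfileODE

variable {B q k θ σ E A μ : ℝ} {w p : ℝ → ℝ}

/-- The profile equation is invariant under `w ↦ μ ^ e w (μ ·)` when `e (q - 1) = 2 - θ`. -/
theorem scale {e : ℝ} (h : ProfileODE B q k θ w p (Ioi 0)) (hμ : 0 < μ)
    (he : e * (q - 1) = 2 - θ) :
    ProfileODE B q k θ (fun y => μ ^ e * w (μ * y)) (fun y => μ ^ (e + 1) * p (μ * y))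
      (Ioi 0) := by
  have hmem : ∀ y : ℝ, y ∈ Ioi (0 : ℝ) → μ * y ∈ Ioi (0 : ℝ) := fun y hy => mul_pos hμ hy
  have hlin : ∀ y : ℝ, HasDerivAt (fun y => μ * y) μ y := fun y => by
    simpa using (hasDerivAt_id y).const_mul μ
  refine ⟨fun y hy => mul_pos (by positivity) (h.pos _ (hmem y hy)), fun y hy => ?_,
    fun y hy => ?_⟩
  · refine ((HasDerivAt.comp y (h.deriv_fst _ (hmem y hy)) (hlin y)).const_mul
      (μ ^ e)).congr_deriv ?_
    rw [Real.rpow_add_one hμ.ne']; ring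
  · have hy0 : (0 : ℝ) < y := hy
    have hw := h.pos _ (hmem y hy)
    refine ((HasDerivAt.comp y (h.deriv_snd _ (hmem y hy)) (hlin y)).const_mul
      (μ ^ (e + 1))).congr_deriv ?_
    rw [Real.mul_rpow (by positivity) hw.le, Real.mul_rpow (by positivity) hw.le,
      Real.mul_rpow hμ.le hy0.le, ← Real.rpow_mul hμ.le, ← Real.rpow_mul hμ.le, he,
      show e * q = e + (2 - θ) by linarith, Real.rpow_add_one hμ.ne', Real.rpow_add hμ e,
      sub_eq_add_neg 2 θ, Real.rpow_add hμ 2, Real.rpow_two]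
    ring

theorem scale_slope {e : ℝ} (hμ : 0 < μ) (hwE : Tendsto (fun y => w y / y) (𝓝[>] 0) (𝓝 E)) :
    Tendsto (fun y => μ ^ e * w (μ * y) / y) (𝓝[>] 0) (𝓝 (μ ^ (e + 1) * E)) := by
  have hlin : Tendsto (fun y : ℝ => μ * y) (𝓝[>] 0) (𝓝[>] 0) := by
    refine tendsto_nhdsWithin_iff.2 ⟨?_, ?_⟩
    · have : Tendsto (fun y : ℝ => μ * y) (𝓝 0) (𝓝 (μ * 0)) := tendsto_id.const_mul μ
      rw [mul_zero] at this
      exact this.mono_left nhdsWithin_le_nhds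
    · filter_upwards [self_mem_nhdsWithin] with y hy
      exact mul_pos hμ hy
  refine ((hwE.comp hlin).const_mul (μ ^ (e + 1))).congr' ?_
  filter_upwards [self_mem_nhdsWithin] with y hy
  have : (0 : ℝ) < y := hy
  simp only [Function.comp]
  rw [Real.rpow_add_one hμ.ne']
  field_simp

theorem scale_limit {e : ℝ} (h : ProfileODE B q k θ w p (Ioi 0)) (hμ : 0 < μ)
    (hA : Tendsto (fun y => y ^ (-k) * w y ^ q) atTop (𝓝 A)) :
    Tendsto (fun y => y ^ (-k) * (μ ^ e * w (μ * y)) ^ q) atTop (𝓝 (μ ^ (e * q + k) * A)) := by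
  refine ((hA.comp (tendsto_id.const_mul_atTop hμ)).const_mul (μ ^ (e * q + k))).congr' ?_
  filter_upwards [eventually_gt_atTop 0] with y hy
  simp only [Function.comp, id]
  rw [Real.mul_rpow hμ.le hy.le, Real.mul_rpow (by positivity) (h.pos _ (mul_pos hμ hy)).le,
    ← Real.rpow_mul hμ.le, Real.rpow_add hμ]
  have : μ ^ k * μ ^ (-k) = 1 := by rw [← Real.rpow_add hμ]; simp
  linear_combination (μ ^ (e * q) * y ^ (-k) * w (μ * y) ^ q) * this

/-- Solutions of the profile equation with the same limit at infinity agree. -/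
theorem eqOn_of_limit {w₁ p₁ w₂ p₂ : ℝ → ℝ} {E₁ E₂ : ℝ}
    (h₁ : ProfileODE B q k θ w₁ p₁ (Ioi 0)) (h₂ : ProfileODE B q k θ w₂ p₂ (Ioi 0))
    (hB : 0 < B) (hq : 1 < q) (hk : 0 < k) (hkq : k < q) (hθ : 0 < q - θ + 1)
    (hδ : (θ - 2) * q < k * (q - 1)) (hE₁ : 0 < E₁) (hE₂ : 0 < E₂)
    (hw₁ : Tendsto (fun y => w₁ y / y) (𝓝[>] 0) (𝓝 E₁))
    (hw₂ : Tendsto (fun y => w₂ y / y) (𝓝[>] 0) (𝓝 E₂)) (hA : 0 < A)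
    (hA₁ : Tendsto (fun y => y ^ (-k) * w₁ y ^ q) atTop (𝓝 A))
    (hA₂ : Tendsto (fun y => y ^ (-k) * w₂ y ^ q) atTop (𝓝 A)) : EqOn w₁ w₂ (Ioi 0) := by
  have hq1 : 0 < q - 1 := by linarith
  set e := (2 - θ) / (q - 1) with he
  have heq : e * (q - 1) = 2 - θ := div_mul_cancel₀ _ hq1.ne'
  have he1 : 0 < e + 1 := by
    have : e + 1 = (q - θ + 1) / (q - 1) := by rw [he]; field_simp; ring
    rw [this]; positivity
  have he2 : 0 < e * q + k := by
    have : e * q + k = (k * (q - 1) - (θ - 2) * q) / (q - 1) := by rw [he]; field_simp; ring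
    rw [this]; exact div_pos (by linarith) hq1
  -- The scaling that gives the first solution the slope of the second.
  set μ := (E₂ / E₁) ^ (1 / (e + 1)) with hμdef
  have hμ : 0 < μ := by positivity
  have hμE : μ ^ (e + 1) * E₁ = E₂ := by
    rw [hμdef, ← Real.rpow_mul (by positivity), one_div_mul_cancel he1.ne', Real.rpow_one]
    field_simp
  have hslope := scale_slope (e := e) hμ hw₁
  rw [hμE] at hslope
  have heqOn := (h₁.scale hμ heq).eqOn_of_slope h₂ hB hq hk hkq rfl hθ hE₂ hslope hw₂
  -- The rescaled first solution is the second one, so their limits agree; since e q + k > 0, this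
  -- forces μ = 1.
  have hAμ : μ ^ (e * q + k) * A = A := by
    refine tendsto_nhds_unique ((h₁.scale_limit (e := e) hμ hA₁).congr' ?_) hA₂
    filter_upwards [eventually_gt_atTop 0] with y hy
    rw [← heqOn hy]
  have hμ1 : μ = 1 := by
    have h1 : μ ^ (e * q + k) = 1 := mul_right_cancel₀ hA.ne' (by rw [hAμ, one_mul])
    exact (Real.rpow_left_inj hμ.le zero_le_one he2.ne').1 (by rw [h1, Real.one_rpow])
  intro y hy
  rw [← heqOn hy, hμ1]
  simp

end ProfileODE

/-- For every `A > 0` there is a solution with `y ^ (-k) w ^ q → A` at infinity. -/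
theorem exists_profile_of_limit {B q k θ A : ℝ} (hB : 0 < B) (hq : 1 < q) (hk : 0 < k)
    (hkq : k < q) (hθ : 0 < q - θ + 1) (hδ : (θ - 2) * q < k * (q - 1)) (hA : 0 < A) :
    ∃ (w p : ℝ → ℝ) (E : ℝ), ProfileODE B q k θ w p (Ioi 0) ∧ 0 < E ∧
      Tendsto (fun y => w y / y) (𝓝[>] 0) (𝓝 E) ∧
      Tendsto (fun y => y ^ (-k) * w y ^ q) atTop (𝓝 A) := by
  obtain ⟨w, p, h, hwE, hpE⟩ := exists_profile hB hq hk hkq rfl hθ one_pos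
  obtain ⟨A₁, hA₁, hlim⟩ := h.exists_limit hB hq hk hkq hδ one_pos hwE hpE
  have hq1 : 0 < q - 1 := by linarith
  set e := (2 - θ) / (q - 1) with he
  have heq : e * (q - 1) = 2 - θ := div_mul_cancel₀ _ hq1.ne'
  have he2 : 0 < e * q + k := by
    have : e * q + k = (k * (q - 1) - (θ - 2) * q) / (q - 1) := by rw [he]; field_simp; ring
    rw [this]; exact div_pos (by linarith) hq1
  -- The scaling that carries the limit A₁ of the solution with unit slope to A.
  set μ := (A / A₁) ^ (1 / (e * q + k)) with hμdef
  have hμ : 0 < μ := by positivity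
  have hμA : μ ^ (e * q + k) * A₁ = A := by
    rw [hμdef, ← Real.rpow_mul (by positivity), one_div_mul_cancel he2.ne', Real.rpow_one]
    field_simp
  have hl := h.scale_limit (e := e) hμ hlim
  rw [hμA] at hl
  exact ⟨_, _, _, h.scale hμ heq, by positivity, ProfileODE.scale_slope hμ hwE, hl⟩

/-! ### Derivatives of radial functions. -/

section Radial

variable {n : ℕ}

theorem hasFDerivAt_radial {V : Type*} [NormedAddCommGroup V] [InnerProductSpace ℝ V]
    {h : ℝ → ℝ} {h' : ℝ} {x : V} (hh : HasDerivAt h h' (‖x‖ ^ 2)) :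
    HasFDerivAt (fun y : V => h (‖y‖ ^ 2)) ((2 * h') • innerSL ℝ x) x := by
  refine (hh.comp_hasFDerivAt x (hasStrictFDerivAt_norm_sq x).hasFDerivAt).congr_fderiv ?_
  ext v
  simp
  ring

/-- As a function of |x|², the differential is 2 h' ⟨x, ·⟩, so the second derivative along a unit
vector e is 4 h'' ⟨e, x⟩² + 2 h'. Parseval sums the squares over an orthonormal basis. -/
theorem laplacian_radial {h h₁ : ℝ → ℝ} {h₂ : ℝ} {x : EuclideanSpace ℝ (Fin n)} (hx : x ≠ 0)
    (hh : ∀ u, 0 < u → HasDerivAt h (h₁ u) u) (hh₁ : HasDerivAt h₁ h₂ (‖x‖ ^ 2)) :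
    Laplacian.laplacian (fun y : EuclideanSpace ℝ (Fin n) => h (‖y‖ ^ 2)) x
      = 4 * ‖x‖ ^ 2 * h₂ + 2 * n * h₁ (‖x‖ ^ 2) := by
  rw [InnerProductSpace.laplacian_eq_iteratedFDeriv_orthonormalBasis _
    (EuclideanSpace.basisFun (Fin n) ℝ)]
  have hev : fderiv ℝ (fun y : EuclideanSpace ℝ (Fin n) => h (‖y‖ ^ 2)) =ᶠ[𝓝 x]
      fun y => (2 * h₁ (‖y‖ ^ 2)) • innerSL ℝ y := by
    filter_upwards [isOpen_ne.mem_nhds hx] with y hy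
    have : 0 < ‖y‖ := norm_pos_iff.2 hy
    exact (hasFDerivAt_radial (hh _ (by positivity))).fderiv
  have hd := ((hasFDerivAt_radial hh₁).const_mul 2).smul
    (innerSL ℝ (E := EuclideanSpace ℝ (Fin n))).hasFDerivAt
  have hfd : fderiv ℝ (fderiv ℝ (fun y : EuclideanSpace ℝ (Fin n) => h (‖y‖ ^ 2))) x = _ :=
    (hd.congr_of_eventuallyEq hev).fderiv
  have key : ∀ i, iteratedFDeriv ℝ 2 (fun y : EuclideanSpace ℝ (Fin n) => h (‖y‖ ^ 2)) x
      ![EuclideanSpace.basisFun (Fin n) ℝ i, EuclideanSpace.basisFun (Fin n) ℝ i]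
      = 4 * h₂ * inner ℝ (EuclideanSpace.basisFun (Fin n) ℝ i) x ^ 2 + 2 * h₁ (‖x‖ ^ 2) := by
    intro i
    have hb : inner ℝ (EuclideanSpace.basisFun (Fin n) ℝ i) (EuclideanSpace.basisFun (Fin n) ℝ i)
        = (1 : ℝ) := by
      rw [real_inner_self_eq_norm_sq, OrthonormalBasis.norm_eq_one, one_pow]
    rw [iteratedFDeriv_two_apply, hfd]
    set e := EuclideanSpace.basisFun (Fin n) ℝ i
    change 2 * h₁ (‖x‖ ^ 2) * inner ℝ e e + 2 * (2 * h₂ * inner ℝ x e) * inner ℝ x e = _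
    rw [hb, real_inner_comm]
    ring
  simp only
  rw [Finset.sum_congr rfl fun i _ => key i, Finset.sum_add_distrib, ← Finset.mul_sum,
    OrthonormalBasis.sum_sq_inner_right]
  simp
  ring

end Radial

/-! ### Passage between the elliptic equation and the profile equation. -/

section Transfer

variable {n : ℕ} {m α β N q : ℝ} {w p p₂ : ℝ → ℝ} {f : EuclideanSpace ℝ (Fin n) → ℝ}

theorem norm_rpow_neg_eq {V : Type*} [NormedAddCommGroup V] (x : V) (N : ℝ) :
    ‖x‖ ^ (-N) = (‖x‖ ^ 2) ^ (-(N / 2)) := by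
  rw [← Real.rpow_natCast_mul (norm_nonneg x)]
  congr 1; push_cast; ring

/-- The Laplacian of `w (|x| ^ (2 - n))`. -/
theorem lapPow_eq (hN : N = n - 2) (hN0 : 0 < N) (hmq : q * m = 1)
    (hw : ∀ y, 0 < y → 0 < w y) (hwd : ∀ y, 0 < y → HasDerivAt w (p y) y)
    (hpd : ∀ y, 0 < y → HasDerivAt p (p₂ y) y)
    (hf : ∀ x, x ≠ 0 → f x = w (‖x‖ ^ (-N)) ^ q) {x : EuclideanSpace ℝ (Fin n)} (hx : x ≠ 0) :
    lapPow m f x = N ^ 2 * (‖x‖ ^ (-N)) ^ (2 + 2 / N) * p₂ (‖x‖ ^ (-N)) := by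
  have hx0 : 0 < ‖x‖ := norm_pos_iff.2 hx
  set a := N / 2 with ha
  have ha0 : 0 < a := by positivity
  have hpow : ∀ u : ℝ, 0 < u → HasDerivAt (fun u : ℝ => u ^ (-a)) (-a * u ^ (-a - 1)) u :=
    fun u hu => Real.hasDerivAt_rpow_const (Or.inl hu.ne')
  have hpow1 : ∀ u : ℝ, 0 < u →
      HasDerivAt (fun u : ℝ => -a * u ^ (-a - 1)) (-a * ((-a - 1) * u ^ (-a - 1 - 1))) u :=
    fun u hu => (Real.hasDerivAt_rpow_const (Or.inl hu.ne')).const_mul _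
  have h1 : ∀ u : ℝ, 0 < u →
      HasDerivAt (fun u : ℝ => w (u ^ (-a))) (p (u ^ (-a)) * (-a * u ^ (-a - 1))) u :=
    fun u hu => (hwd _ (by positivity)).comp u (hpow u hu)
  have hu : 0 < ‖x‖ ^ 2 := by positivity
  have h2 := (HasDerivAt.comp (‖x‖ ^ 2) (hpd _ (by positivity)) (hpow _ hu)).mul (hpow1 _ hu)
  have hev : (fun y => f y ^ m) =ᶠ[𝓝 x] fun y => w ((‖y‖ ^ 2) ^ (-a)) := by
    filter_upwards [isOpen_ne.mem_nhds hx] with y hy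
    have hy0 : 0 < ‖y‖ := norm_pos_iff.2 hy
    rw [hf y hy, ← Real.rpow_mul (hw _ (by positivity)).le, hmq, Real.rpow_one,
      norm_rpow_neg_eq]
  rw [lapPow, (InnerProductSpace.laplacian_congr_nhds hev).self_of_nhds,
    laplacian_radial (h := fun u => w (u ^ (-a))) hx h1 h2, norm_rpow_neg_eq, ← ha]
  set u := ‖x‖ ^ 2
  -- With this value of n the terms in w' cancel: |x|^(2-n) is harmonic, so only w'' remains.
  have hn : (n : ℝ) = 2 * a + 2 := by rw [ha]; linarith
  have hN2 : N = 2 * a := by rw [ha]; ring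
  have h3 : (u ^ (-a)) ^ (2 + 2 / N) = u ^ (-a) * u ^ (-a) / u := by
    rw [← Real.rpow_mul hu.le, ← Real.rpow_add hu, ← Real.rpow_sub_one hu.ne']
    congr 1; rw [hN2]; field_simp; ring
  rw [h3, hn, hN2]
  simp only [Function.comp, Real.rpow_sub_one hu.ne']
  field_simp
  ring

theorem drift_eq (hw : ∀ y, 0 < y → 0 < w y) (hwd : ∀ y, 0 < y → HasDerivAt w (p y) y)
    (hf : ∀ x, x ≠ 0 → f x = w (‖x‖ ^ (-N)) ^ q) {x : EuclideanSpace ℝ (Fin n)} (hx : x ≠ 0) :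
    drift α β f x = α * w (‖x‖ ^ (-N)) ^ q
      - β * N * q * (‖x‖ ^ (-N) * w (‖x‖ ^ (-N)) ^ (q - 1) * p (‖x‖ ^ (-N))) := by
  have hx0 : 0 < ‖x‖ := norm_pos_iff.2 hx
  have hu : 0 < ‖x‖ ^ 2 := by positivity
  have hy : 0 < (‖x‖ ^ 2) ^ (-(N / 2)) := by positivity
  have h1 := (HasDerivAt.comp (‖x‖ ^ 2) (hwd _ hy)
    (Real.hasDerivAt_rpow_const (p := -(N / 2)) (Or.inl hu.ne'))).rpow_const (p := q)
    (Or.inl (hw _ hy).ne')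
  have hev : f =ᶠ[𝓝 x]
      fun y => ((w ∘ fun u : ℝ => u ^ (-(N / 2))) (‖y‖ ^ 2)) ^ q := by
    filter_upwards [isOpen_ne.mem_nhds hx] with y hy
    rw [hf y hy, norm_rpow_neg_eq]; rfl
  have hfd := ((hasFDerivAt_radial h1).congr_of_eventuallyEq hev).fderiv
  rw [drift, inner_gradient_right, hfd, hf x hx, norm_rpow_neg_eq]
  simp only [smul_apply, innerSL_apply_apply, real_inner_self_eq_norm_sq,
    Function.comp, smul_eq_mul, conj_trivial, Real.rpow_sub_one hu.ne']
  field_simp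
  ring

end Transfer

section Transfer

variable {n : ℕ} {m α β N q k θ B A : ℝ} {w p : ℝ → ℝ} {f : EuclideanSpace ℝ (Fin n) → ℝ}

theorem contDiffOn_two_of_hasDerivAt {p₂ : ℝ → ℝ} (hwd : ∀ y, 0 < y → HasDerivAt w (p y) y)
    (hpd : ∀ y, 0 < y → HasDerivAt p (p₂ y) y) (hc : ContinuousOn p₂ (Ioi 0)) :
    ContDiffOn ℝ 2 w (Ioi 0) := by
  have h1 : ContDiffOn ℝ 1 p (Ioi 0) := by
    rw [show (1 : WithTop ℕ∞) = 0 + 1 from (zero_add 1).symm,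
      contDiffOn_succ_iff_deriv_of_isOpen isOpen_Ioi]
    refine ⟨fun y hy => (hpd y hy).differentiableAt.differentiableWithinAt, by simp, ?_⟩
    rw [contDiffOn_zero]
    exact hc.congr fun y hy => (hpd y hy).deriv
  rw [show (2 : WithTop ℕ∞) = 1 + 1 from one_add_one_eq_two.symm,
    contDiffOn_succ_iff_deriv_of_isOpen isOpen_Ioi]
  refine ⟨fun y hy => (hwd y hy).differentiableAt.differentiableWithinAt, by simp, ?_⟩
  exact h1.congr fun y hy => (hwd y hy).deriv

theorem ProfileODE.contDiffOn (h : ProfileODE B q k θ w p (Ioi 0)) : ContDiffOn ℝ 2 w (Ioi 0) := by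
  have hne : ∀ y ∈ Ioi (0 : ℝ), y ≠ 0 := fun y hy => (show (0 : ℝ) < y from hy).ne'
  have hwc : ContinuousOn w (Ioi 0) := fun y hy =>
    (h.deriv_fst y hy).continuousAt.continuousWithinAt
  have hpc : ContinuousOn p (Ioi 0) := fun y hy =>
    (h.deriv_snd y hy).continuousAt.continuousWithinAt
  have hwr : ∀ r : ℝ, ContinuousOn (fun y => w y ^ r) (Ioi 0) := fun r =>
    hwc.rpow_const fun y hy => Or.inl (h.pos y hy).ne'
  have hr : ContinuousOn (fun y : ℝ => y ^ (-θ)) (Ioi 0) :=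
    continuousOn_id.rpow_const fun y hy => Or.inl (hne y hy)
  exact contDiffOn_two_of_hasDerivAt h.deriv_fst h.deriv_snd
    ((continuousOn_const.mul hr).mul ((continuousOn_const.mul (hwr q)).sub
      (((continuousOn_const.mul continuousOn_id).mul (hwr (q - 1))).mul hpc)))

theorem contDiffOn_radial (hw : ∀ y, 0 < y → 0 < w y) (hwc : ContDiffOn ℝ 2 w (Ioi 0)) :
    ContDiffOn ℝ 2 (fun x : EuclideanSpace ℝ (Fin n) => w (‖x‖ ^ (-N)) ^ q) {0}ᶜ := by
  have hpos : ∀ x ∈ ({0}ᶜ : Set (EuclideanSpace ℝ (Fin n))), 0 < ‖x‖ := fun x hx =>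
    norm_pos_iff.2 hx
  have h1 : ContDiffOn ℝ 2 (fun x : EuclideanSpace ℝ (Fin n) => ‖x‖) {0}ᶜ := fun x hx =>
    (contDiffAt_norm ℝ hx).contDiffWithinAt
  have h2 : ContDiffOn ℝ 2 (fun x : EuclideanSpace ℝ (Fin n) => ‖x‖ ^ (-N)) {0}ᶜ :=
    h1.rpow_const_of_ne fun x hx => (hpos x hx).ne'
  exact (hwc.comp h2 fun x hx => Real.rpow_pos_of_pos (hpos x hx) _).rpow_const_of_ne
    fun x hx => (hw _ (Real.rpow_pos_of_pos (hpos x hx) _)).ne'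

/-- The parameters of the profile equation belonging to those of the elliptic equation. -/
structure Params (n : ℕ) (m α β N q k θ B : ℝ) : Prop where
  N_eq : N = n - 2
  N_pos : 0 < N
  q_mul_m : q * m = 1
  m_pos : 0 < m
  β_neg : β < 0
  k_eq : k = α / β / N
  θ_eq : θ = 2 + 2 / N
  B_eq : B = -β / N

/-- In the radial variable, the elliptic operator vanishes exactly if the profile equation
holds. -/
theorem Params.operator_eq (P : Params n m α β N q k θ B) {p₂ : ℝ → ℝ}
    (hw : ∀ y, 0 < y → 0 < w y) (hwd : ∀ y, 0 < y → HasDerivAt w (p y) y)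
    (hpd : ∀ y, 0 < y → HasDerivAt p (p₂ y) y)
    (hf : ∀ x, x ≠ 0 → f x = w (‖x‖ ^ (-N)) ^ q) {x : EuclideanSpace ℝ (Fin n)} (hx : x ≠ 0)
    {y : ℝ} (hy : y = ‖x‖ ^ (-N)) :
    lapPow m f x + drift α β f x = N ^ 2 * y ^ θ *
      (p₂ y - B * y ^ (-θ) * (k * w y ^ q - q * y * w y ^ (q - 1) * p y)) := by
  have hx0 : 0 < ‖x‖ := norm_pos_iff.2 hx
  have hy0 : 0 < y := by rw [hy]; positivity
  have hN := P.N_pos.ne'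
  have hβ := P.β_neg.ne
  rw [lapPow_eq P.N_eq P.N_pos P.q_mul_m hw hwd hpd hf hx, drift_eq hw hwd hf hx, ← hy,
    ← P.θ_eq, P.B_eq, P.k_eq, Real.rpow_neg hy0.le]
  have : 0 < y ^ θ := by positivity
  field_simp
  ring

theorem tendsto_norm_rpow_neg_nhds_zero (hN : 0 < N) :
    Tendsto (fun x : EuclideanSpace ℝ (Fin n) => ‖x‖ ^ (-N)) (𝓝[≠] 0) atTop :=
  (tendsto_rpow_neg_nhdsGT_zero (neg_neg_of_pos hN)).comp tendsto_norm_nhdsNE_zero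

theorem tendsto_norm_rpow_neg_cobounded (hN : 0 < N) :
    Tendsto (fun x : EuclideanSpace ℝ (Fin n) => ‖x‖ ^ (-N)) (Bornology.cobounded _)
      (𝓝[>] 0) := by
  refine tendsto_nhdsWithin_iff.2
    ⟨(tendsto_rpow_neg_atTop hN).comp tendsto_norm_cobounded_atTop, ?_⟩
  filter_upwards [tendsto_norm_cobounded_atTop.eventually (eventually_gt_atTop 0)] with x hx
  exact Real.rpow_pos_of_pos hx _

theorem Params.origin_eq (P : Params n m α β N q k θ B)
    (hf : ∀ x, x ≠ 0 → f x = w (‖x‖ ^ (-N)) ^ q) {x : EuclideanSpace ℝ (Fin n)} (hx : x ≠ 0) :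
    ‖x‖ ^ (α / β) * f x = (‖x‖ ^ (-N)) ^ (-k) * w (‖x‖ ^ (-N)) ^ q := by
  have hN := P.N_pos.ne'
  rw [hf x hx, ← Real.rpow_mul (norm_nonneg x), P.k_eq]
  congr 2
  field_simp

theorem Params.infty_eq (P : Params n m α β N q k θ B) (hw : ∀ y, 0 < y → 0 < w y)
    (hf : ∀ x, x ≠ 0 → f x = w (‖x‖ ^ (-N)) ^ q) {x : EuclideanSpace ℝ (Fin n)} (hx : x ≠ 0) :
    ‖x‖ ^ (((n : ℝ) - 2) / m) * f x = (w (‖x‖ ^ (-N)) / ‖x‖ ^ (-N)) ^ q := by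
  have hx0 : 0 < ‖x‖ := norm_pos_iff.2 hx
  have hm := P.m_pos.ne'
  rw [hf x hx, Real.div_rpow (hw _ (by positivity)).le (by positivity),
    ← Real.rpow_mul (norm_nonneg x), ← P.N_eq]
  have : N / m = -(-N * q) := by
    field_simp
    linear_combination -N * P.q_mul_m
  rw [this, Real.rpow_neg (norm_nonneg x)]
  ring

/-- A solution of the profile equation gives a radial profile. -/
theorem Params.isRadialProfile (P : Params n m α β N q k θ B)
    (h : ProfileODE B q k θ w p (Ioi 0)) {E : ℝ} (hE : 0 < E)
    (hwE : Tendsto (fun y => w y / y) (𝓝[>] 0) (𝓝 E))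
    (hA : Tendsto (fun y => y ^ (-k) * w y ^ q) atTop (𝓝 A)) :
    IsRadialProfile n m α β (fun x => w (‖x‖ ^ (-N)) ^ q) ∧
      OriginBehaviour α β A (fun x : EuclideanSpace ℝ (Fin n) => w (‖x‖ ^ (-N)) ^ q) ∧
      ∃ D : ℝ, 0 < D ∧
        InftyBehaviour m D (fun x : EuclideanSpace ℝ (Fin n) => w (‖x‖ ^ (-N)) ^ q) := by
  refine ⟨⟨contDiffOn_radial h.pos h.contDiffOn, fun x hx => ?_, fun x y hxy => ?_,
    fun x hx => ?_⟩, ?_, E ^ q, by positivity, ?_⟩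
  · have hx0 : 0 < ‖x‖ := norm_pos_iff.2 hx
    have := h.pos (‖x‖ ^ (-N)) (Real.rpow_pos_of_pos hx0 _)
    positivity
  · rw [hxy]
  · rw [P.operator_eq h.pos h.deriv_fst h.deriv_snd (fun _ _ => rfl) hx rfl, sub_self, mul_zero]
  · refine (hA.comp (tendsto_norm_rpow_neg_nhds_zero P.N_pos)).congr' ?_
    filter_upwards [self_mem_nhdsWithin] with x hx
    exact (P.origin_eq (w := w) (fun _ _ => rfl) hx).symm
  · have h1 := hwE.comp (tendsto_norm_rpow_neg_cobounded (n := n) P.N_pos)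
    refine (h1.rpow_const (p := q) (Or.inl hE.ne')).congr' ?_
    filter_upwards [tendsto_norm_cobounded_atTop.eventually (eventually_gt_atTop 0)] with x hx
    exact (P.infty_eq h.pos (fun _ _ => rfl) (norm_pos_iff.1 hx)).symm

/-- A radial profile comes from a solution of the profile equation. -/
theorem Params.exists_profileODE (P : Params n m α β N q k θ B)
    (hf : IsRadialProfile n m α β f) (hA : OriginBehaviour α β A f)
    {D : ℝ} (hD : 0 < D) (hfD : InftyBehaviour m D f) :
    ∃ w p : ℝ → ℝ, ∃ E : ℝ, ProfileODE B q k θ w p (Ioi 0) ∧ 0 < E ∧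
      Tendsto (fun y => w y / y) (𝓝[>] 0) (𝓝 E) ∧
      Tendsto (fun y => y ^ (-k) * w y ^ q) atTop (𝓝 A) ∧
      ∀ x, x ≠ 0 → f x = w (‖x‖ ^ (-N)) ^ q := by
  have hN := P.N_pos
  have hn : 0 < n := by
    have h1 := P.N_eq
    have : (0 : ℝ) < n := by linarith
    exact_mod_cast this
  set e₀ : EuclideanSpace ℝ (Fin n) := EuclideanSpace.basisFun (Fin n) ℝ ⟨0, hn⟩ with he₀
  have he₀n : ‖e₀‖ = 1 := OrthonormalBasis.norm_eq_one _ _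
  -- A ray parametrized by y = |x|^(-N); by radial symmetry f is determined by its values there.
  set c : ℝ → EuclideanSpace ℝ (Fin n) := fun y => y ^ (-(1 / N)) • e₀ with hc
  have hcn : ∀ y, 0 < y → ‖c y‖ = y ^ (-(1 / N)) := fun y hy => by
    rw [hc]
    simp only
    rw [norm_smul, he₀n, mul_one, Real.norm_eq_abs, abs_of_pos (by positivity)]
  have hc0 : ∀ y, 0 < y → c y ≠ 0 := fun y hy => by
    rw [← norm_pos_iff, hcn y hy]; positivity
  have hcN : ∀ y, 0 < y → ‖c y‖ ^ (-N) = y := fun y hy => by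
    rw [hcn y hy, ← Real.rpow_mul hy.le]
    have : -(1 / N) * -N = 1 := by field_simp
    rw [this, Real.rpow_one]
  set w : ℝ → ℝ := fun y => f (c y) ^ m with hw
  have hwpos : ∀ y, 0 < y → 0 < w y := fun y hy =>
    Real.rpow_pos_of_pos (hf.pos _ (hc0 y hy)) _
  have hfw : ∀ x, x ≠ 0 → f x = w (‖x‖ ^ (-N)) ^ q := fun x hx => by
    have hx0 : 0 < ‖x‖ := norm_pos_iff.2 hx
    have hy : 0 < ‖x‖ ^ (-N) := by positivity
    have hnorm : ‖c (‖x‖ ^ (-N))‖ = ‖x‖ := by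
      rw [hcn _ hy, ← Real.rpow_mul hx0.le]
      have : -N * -(1 / N) = 1 := by field_simp
      rw [this, Real.rpow_one]
    rw [hw]
    simp only
    rw [← Real.rpow_mul (hf.pos _ (hc0 _ hy)).le, mul_comm m, P.q_mul_m, Real.rpow_one]
    exact hf.radial _ _ hnorm.symm
  have hcc : ContDiffOn ℝ 2 c (Ioi 0) :=
    (contDiffOn_id.rpow_const_of_ne fun y hy => (show (0 : ℝ) < y from hy).ne').smul
      contDiffOn_const
  have hwc : ContDiffOn ℝ 2 w (Ioi 0) :=
    (hf.contDiffOn.comp hcc fun y hy => hc0 y hy).rpow_const_of_ne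
      fun y hy => (hf.pos _ (hc0 y hy)).ne'
  rw [show (2 : WithTop ℕ∞) = 1 + 1 from one_add_one_eq_two.symm,
    contDiffOn_succ_iff_deriv_of_isOpen isOpen_Ioi] at hwc
  have hwd : ∀ y, 0 < y → HasDerivAt w (deriv w y) y := fun y hy =>
    ((hwc.1 y hy).differentiableAt (Ioi_mem_nhds hy)).hasDerivAt
  have hpd : ∀ y, 0 < y → HasDerivAt (deriv w) (deriv (deriv w) y) y := fun y hy =>
    ((hwc.2.2.differentiableOn one_ne_zero y hy).differentiableAt (Ioi_mem_nhds hy)).hasDerivAt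
  have hode : ProfileODE B q k θ w (deriv w) (Ioi 0) := by
    refine ⟨hwpos, hwd, fun y hy => ?_⟩
    have hy0 : (0 : ℝ) < y := hy
    have h1 := P.operator_eq hwpos hwd hpd hfw (hc0 y hy) (hcN y hy).symm
    rw [hf.equation _ (hc0 y hy)] at h1
    -- The elliptic operator is this factor times the defect in the profile equation, so the defect
    -- vanishes.
    have h2 : N ^ 2 * y ^ θ ≠ 0 := by positivity
    have h3 := (mul_eq_zero.1 h1.symm).resolve_left h2
    rw [← sub_eq_zero.1 h3]
    exact hpd y hy
  refine ⟨w, deriv w, D ^ m, hode, by positivity, ?_, ?_, hfw⟩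
  · have hcob : Tendsto c (𝓝[>] 0) (Bornology.cobounded _) := by
      rw [← tendsto_norm_atTop_iff_cobounded]
      refine (tendsto_rpow_neg_nhdsGT_zero (y := -(1 / N))
        (neg_neg_of_pos (by positivity))).congr' ?_
      filter_upwards [self_mem_nhdsWithin] with y hy
      exact (hcn y hy).symm
    refine ((hfD.comp hcob).rpow_const (p := m) (Or.inl hD.ne')).congr' ?_
    filter_upwards [self_mem_nhdsWithin] with y hy
    have hy0 : (0 : ℝ) < y := hy
    simp only [Function.comp]
    rw [P.infty_eq hwpos hfw (hc0 y hy), hcN y hy,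
      ← Real.rpow_mul (div_pos (hwpos y hy) hy0).le, P.q_mul_m, Real.rpow_one]
  · have hcz : Tendsto c atTop (𝓝[≠] 0) := by
      refine tendsto_nhdsWithin_iff.2 ⟨?_, ?_⟩
      · have := (tendsto_rpow_neg_atTop (y := 1 / N) (by positivity)).smul_const e₀
        rwa [zero_smul] at this
      · filter_upwards [eventually_gt_atTop 0] with y hy
        exact hc0 y hy
    refine (hA.comp hcz).congr' ?_
    filter_upwards [eventually_gt_atTop 0] with y hy
    simp only [Function.comp]
    rw [P.origin_eq hfw (hc0 y hy), hcN y hy]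

end Transfer

end SelfSimilar

/-! ### Parameter ranges and conclusion. -/

theorem theorem1p1 (n : ℕ) (hn : 3 ≤ n) (m : ℝ) (hm0 : 0 < m) (hm1 : m < ((n : ℝ) - 2) / n)
    (α β ρ₁ : ℝ) (hβ : β < 0) (hρ₁ : 0 < ρ₁) (hα : α = (2 * β - ρ₁) / (1 - m))
    (hlow : 2 / (1 - m) < α / β) (hupp : α / β < ((n : ℝ) - 2) / m)
    (A : ℝ) (hA : 0 < A) :
    ∃ f : EuclideanSpace ℝ (Fin n) → ℝ,
      -- existence
      (SelfSimilar.IsRadialProfile n m α β f ∧ SelfSimilar.OriginBehaviour α β A f ∧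
        ∃ D : ℝ, 0 < D ∧ SelfSimilar.InftyBehaviour m D f) ∧
      -- uniqueness, as a function on the complement of the origin
      (∀ g : EuclideanSpace ℝ (Fin n) → ℝ,
        (SelfSimilar.IsRadialProfile n m α β g ∧ SelfSimilar.OriginBehaviour α β A g ∧
          ∃ D : ℝ, 0 < D ∧ SelfSimilar.InftyBehaviour m D g) →
        ∀ x, x ≠ 0 → g x = f x) ∧
      -- sign of the Laplacian
      (∀ x, x ≠ 0 → SelfSimilar.lapPow m f x = -SelfSimilar.drift α β f x ∧
        SelfSimilar.lapPow m f x < 0) := by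
  have hn3 : (3 : ℝ) ≤ n := by exact_mod_cast hn
  have hn0 : (0 : ℝ) < n := by linarith
  set N : ℝ := n - 2 with hNdef
  have hN : 0 < N := by linarith
  have hmn : m * n < N := by rwa [lt_div_iff₀ hn0] at hm1
  have hm : m < 1 := by nlinarith
  set q := 1 / m with hqdef
  set k := α / β / N with hkdef
  set θ := 2 + 2 / N with hθdef
  set B := -β / N with hBdef
  have P : SelfSimilar.Params n m α β N q k θ B :=
    ⟨rfl, hN, one_div_mul_cancel hm0.ne', hm0, hβ, rfl, rfl, rfl⟩
  have hB : 0 < B := div_pos (by linarith) hN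
  have hq : 1 < q := by rw [hqdef, lt_div_iff₀ hm0]; linarith
  have hγ : 0 < α / β := lt_trans (div_pos two_pos (by linarith)) hlow
  have hk : 0 < k := div_pos hγ hN
  -- This is the upper bound on α/β.
  have hkq : k < q := by
    rw [hkdef, div_lt_iff₀ hN]
    calc α / β < N / m := hupp
      _ = q * N := by rw [hqdef]; ring
  -- This is m < (n - 2)/n, the condition that makes the Volterra exponent σ positive.
  have hθ : 0 < q - θ + 1 := by
    have : q - θ + 1 = (N - m * n) / (m * N) := by
      have hnN : (n : ℝ) = N + 2 := by rw [hNdef]; ring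
      rw [hqdef, hθdef, hnN]; field_simp; ring
    rw [this]; exact div_pos (by linarith) (by positivity)
  -- This is the lower bound on α/β; it provides both the damping at infinity and the positive
  -- scaling exponent of A.
  have hδ : (θ - 2) * q < k * (q - 1) := by
    rw [div_lt_iff₀ (by linarith)] at hlow
    have h1 : (θ - 2) * q = 2 / (N * m) := by rw [hθdef, hqdef]; field_simp; ring
    have h2 : k * (q - 1) = α / β * (1 - m) / (N * m) := by
      rw [hkdef, hqdef]; field_simp
    rw [h1, h2]
    gcongr
  obtain ⟨w, p, E, hw, hE, hwE, hwA⟩ :=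
    SelfSimilar.exists_profile_of_limit hB hq hk hkq hθ hδ hA
  have hsol := P.isRadialProfile hw hE hwE hwA
  refine ⟨_, hsol, ?_, fun x hx => ⟨eq_neg_of_add_eq_zero_left (hsol.1.equation x hx), ?_⟩⟩
  · rintro g ⟨hg, hgA, D, hD, hgD⟩ x hx
    obtain ⟨w', p', E', hw', hE', hwE', hwA', hgw⟩ := P.exists_profileODE hg hgA hD hgD
    have hx0 : 0 < ‖x‖ := norm_pos_iff.2 hx
    rw [hgw x hx, hw'.eqOn_of_limit hw hB hq hk hkq hθ hδ hE' hE hwE' hwE hA hwA' hwA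
      (show ‖x‖ ^ (-N) ∈ Set.Ioi 0 from Real.rpow_pos_of_pos hx0 _)]
  · have hx0 : 0 < ‖x‖ := norm_pos_iff.2 hx
    have hy : 0 < ‖x‖ ^ (-N) := Real.rpow_pos_of_pos hx0 _
    rw [SelfSimilar.lapPow_eq rfl hN P.q_mul_m hw.pos hw.deriv_fst hw.deriv_snd
      (fun _ _ => rfl) hx]
    have hpE := (hw.exists_volterra hq rfl hθ hwE).1
    -- Concavity of w; the interval (0, y + 1) only serves to contain y = |x|^(-N).
    exact mul_neg_of_pos_of_neg (by positivity)
      ((hw.mono (show Set.Ioo 0 (‖x‖ ^ (-N) + 1) ⊆ Set.Ioi 0 from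
        Set.Ioo_subset_Ioi_self)).rhs_neg hB hk hkq hE hwE hpE ⟨hy, lt_add_one _⟩)
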